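/- Let $d \ge 1$, let $p > 1$ be an odd integer, let $\sigma > 0$ and $s > \frac d2 - \frac1p$. For real $r$ let $G^{\sigma,r}(\mathbb{R}^d)$ be the space of functions $f : \mathbb{R}^d \to \mathbb{C}$ with finite norm $$\|f\|_{G^{\sigma,r}} = \Big(\int_{\mathbb{R}^d} e^{2\sigma|\xi|}(1+|\xi|^2)^{r}\,|\widehat f(\xi)|^2\,d\xi\Big)^{1/2},\qquad \widehat f(\xi)=\int_{\mathbb{R}^d}e^{-ix\cdot\xi}f(x)\,dx .$$ Then the Cauchy problem $$u_{tt}-\Delta u+|u|^{p-1}u=0,\qquad u(\cdot,0)=u_0,\qquad u_t(\cdot,0)=u_1$$ for complex-valued $u$ is unconditionally locally well-posed in $G^{\sigma,s}(\mathbb{R}^d)\times G^{\sigma,s-1}(\mathbb{R}^d)$. That is, for every $(u_0,u_1)\in G^{\sigma,s}(\mathbb{R}^d)\times G^{\sigma,s-1}(\mathbb{R}^d)$ there are $\delta>0$ and a neighbourhood $B$ of $(u_0,u_1)$ in $G^{\sigma,s}(\mathbb{R}^d)\times G^{\sigma,s-1}(\mathbb{R}^d)$ such that for all data $(a,b)\in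 B$ (in particular for $(u_0,u_1)$ itself) the Cauchy problem with data $(a,b)$ has exactly one solution $$u\in C([0,\delta);G^{\sigma,s}(\mathbb{R}^d))\cap C^1([0,\delta);G^{\sigma,s-1}(\mathbb{R}^d)),$$ where the equation is understood in the sense of distributions in $x$ at each time $t\in[0,\delta)$. The solution depends continuously on the data: the map $(a,b)\mapsto(u,u_t)$ is continuous on $B$ with respect to the norm $\sup_{t\in[0,\delta)}\big(\|u(\cdot,t)\|_{G^{\sigma,s}}+\|u_t(\cdot,t)\|_{G^{\sigma,s-1}}\big)$. Thus spatial analyticity persists for short times: for every $t\in[0,\delta)$, $u(\cdot,t)$ is the restriction to $\mathbb{R}^d$ of a function holomorphic in the tube $\{x+iy\in\mathbb{C}^d: |y|<\sigma\}$. -/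

import Mathlib

open MeasureTheory Filter Set Topology
open scoped ENNReal FourierTransform SchwartzMap Laplacian

namespace GevreyNLW

noncomputable section

/-- `ℝ^d` with its Euclidean norm. -/
abbrev Space (d : ℕ) : Type := EuclideanSpace ℝ (Fin d)

/-- `L²(ℝ^d; ℂ)`, functions being identified when they agree almost everywhere. -/
abbrev L2 (d : ℕ) : Type := Lp ℂ 2 (volume : Measure (Space d))

/-- The (Plancherel) Fourier transform of `f ∈ L²(ℝ^d)` with the normalization
`f̂(ξ) = ∫ e^{- i x · ξ} f(x) dx`. The transform `𝓕` has the kernel `e^{- 2 π i x · ξ}`, which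
accounts for the dilation. -/
def hat {d : ℕ} (f : L2 d) (ξ : Space d) : ℂ :=
  (𝓕 f : L2 d) ((2 * Real.pi)⁻¹ • ξ)

/-- The norm
`‖f‖_{G^{σ,s}} = (∫ e^{2 σ |ξ|} ⟨ξ⟩^{2 s} |f̂(ξ)|² dξ)^{1/2}`, with `⟨ξ⟩ = (1 + |ξ|²)^{1/2}`,
as an extended nonnegative number. -/
def gevreyNorm {d : ℕ} (σ s : ℝ) (f : L2 d) : ℝ≥0∞ :=
  (∫⁻ ξ : Space d,
    ENNReal.ofReal (Real.exp (2 * σ * ‖ξ‖) * (1 + ‖ξ‖ ^ 2) ^ s) * ‖hat f ξ‖ₑ ^ 2) ^ (1 / 2 : ℝ)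

/-- `f ∈ G^{σ,s}(ℝ^d)`. For `σ > 0`, the only case in use, the weight in the norm is bounded below
by a positive constant whatever `s` is, so that `G^{σ,s}(ℝ^d)` is contained in `L²(ℝ^d)`. -/
def MemGevrey {d : ℕ} (σ s : ℝ) (f : L2 d) : Prop :=
  gevreyNorm σ s f < ⊤

/-- `u ∈ C([0,δ); G^{σ,s}(ℝ^d))`. -/
def ContinuousInGevrey {d : ℕ} (σ s δ : ℝ) (u : ℝ → L2 d) : Prop :=
  ∀ t ∈ Ico 0 δ, MemGevrey σ s (u t) ∧
    Tendsto (fun τ : ℝ => gevreyNorm σ s (u τ - u t)) (𝓝[Ico 0 δ] t) (𝓝 0)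

/-- `v` is the time derivative of `u` on `[0,δ)` in the norm of `G^{σ,s}(ℝ^d)`
(a one-sided derivative at `t = 0`). -/
def HasTimeDerivInGevrey {d : ℕ} (σ s δ : ℝ) (u v : ℝ → L2 d) : Prop :=
  ∀ t ∈ Ico 0 δ,
    Tendsto (fun τ : ℝ => gevreyNorm σ s ((τ - t)⁻¹ • (u τ - u t) - v t))
      (𝓝[Ico 0 δ \ {t}] t) (𝓝 0)

/-- `u_tt - Δu + |u|^{p-1} u = 0` on `[0,δ) × ℝ^d`, where `v` stands for `u_t`, in the sense of
(tempered) distributions on `ℝ^d`: for every test function `ψ` and every time `t`,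
`d/dt ⟨v(t), ψ⟩ = ⟨u(t), Δψ⟩ - ⟨|u(t)|^{p-1} u(t), ψ⟩`,
the last pairing being an absolutely convergent integral. -/
def SolvesNLW {d : ℕ} (p : ℕ) (δ : ℝ) (u v : ℝ → L2 d) : Prop :=
  ∀ t ∈ Ico 0 δ, ∀ ψ : 𝓢(Space d, ℂ),
    Integrable (fun x : Space d => ((‖u t x‖ ^ (p - 1) : ℝ) : ℂ) * u t x * ψ x) volume ∧
    HasDerivWithinAt (fun τ : ℝ => ∫ x : Space d, v τ x * ψ x)
      ((∫ x : Space d, u t x * (Δ ψ) x) -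
        ∫ x : Space d, ((‖u t x‖ ^ (p - 1) : ℝ) : ℂ) * u t x * ψ x)
      (Ico 0 δ) t

/-- `u ∈ C([0,δ); G^{σ,s}) ∩ C¹([0,δ); G^{σ,s-1})`, with time derivative `u_t = v`, is a solution of
`u_tt - Δu + |u|^{p-1} u = 0`, `u(0) = u₀`, `u_t(0) = u₁`. -/
structure IsSolution {d : ℕ} (p : ℕ) (σ s δ : ℝ) (u₀ u₁ : L2 d) (u v : ℝ → L2 d) : Prop where
  continuous : ContinuousInGevrey σ s δ u
  hasTimeDeriv : HasTimeDerivInGevrey σ (s - 1) δ u v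
  continuous_deriv : ContinuousInGevrey σ (s - 1) δ v
  equation : SolvesNLW p δ u v
  init : u 0 = u₀
  init_deriv : v 0 = u₁

/-- The distance between two pairs in `G^{σ,s}(ℝ^d) × G^{σ,s-1}(ℝ^d)`. -/
def pairDist {d : ℕ} (σ s : ℝ) (f₀ f₁ g₀ g₁ : L2 d) : ℝ≥0∞ :=
  gevreyNorm σ s (f₀ - g₀) + gevreyNorm σ (s - 1) (f₁ - g₁)

/-- `f` is (almost everywhere) the restriction to `ℝ^d` of a function that is holomorphic in the
tube `{x + i y ∈ ℂ^d : |y| < σ}`. -/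
def AnalyticInTube {d : ℕ} (σ : ℝ) (f : L2 d) : Prop :=
  ∃ F : EuclideanSpace ℂ (Fin d) → ℂ,
    DifferentiableOn ℂ F {z | Real.sqrt (∑ j, (z j).im ^ 2) < σ} ∧
    ∀ᵐ x : Space d, f x = F (WithLp.toLp 2 (fun j => ((x j : ℝ) : ℂ)))

end

end GevreyNLW

/-!
The wave equation is written as the Klein–Gordon equation `u_tt + ⟨D⟩² u = u - |u|^{p-1} u`, where
`⟨D⟩` is the Fourier multiplier `(1 + |ξ|²)^{1/2}`, and everything is transported to `L²` by dividing
by the weights: `u = synth hσ s U` and `v = synth hσ (s - 1) V`, where `synth hσ r` divides by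
`e^{σ|ξ|} ⟨ξ⟩^r` and inverts the Fourier transform. It is injective with range `G^{σ,r}`, and
isometric up to a constant. For `z = (U, V)` the equation becomes `z' = ⟨ξ⟩ J z + F z`, where `J` is
the quarter turn `(U, V) ↦ (V, -U)`, `⟨ξ⟩ J` generates the group of rotations by the angle `t ⟨ξ⟩`,
and `F` involves only multiplication by `⟨ξ⟩⁻¹` and the nonlinearity.

*The nonlinearity.* Since `p` is odd, `|u|^{p-1} u` is a product of `p` factors, each of them `u` or
its conjugate. The exponential weight is submultiplicative along convolutions, so the product law
`G^{σ,a} · G^{σ,b} ⊆ G^{σ,c}` (`exists_synth_mul`) follows from the Sobolev one: it holds when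
`c ≤ a`, `c ≤ b`, `0 ≤ a + b` and `a + b - c > d/2`, because the two largest of three frequencies
that sum to zero are comparable (`bracket_kernel_le`). Multiplying by one factor at a time, with a
loss of `1/p` derivatives per product, gives exponents `s - n/p`; the conditions on the exponents
follow from `s > d/2 - 1/p`, and the total loss `(p - 1)/p` is at most `1`. Hence the nonlinearity maps
`G^{σ,s}` to `G^{σ,s-1}` and is Lipschitz on bounded sets (`exists_nonlinearity`), so that `F` is
Lipschitz on bounded subsets of `L² × L²`.

*Existence and unconditional uniqueness.* A solution in the sense of distributions satisfies the
first-order system strongly after multiplication by `⟨ξ⟩⁻¹`, and conversely (`solvesNLW_iff`): a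
curve that is differentiable when tested against a separating family of functionals, with
continuous derivative, is differentiable (`hasDerivWithinAt_of_separating`). Passing to the
interaction picture `y(t) = T(-t) z(t)` with the rotation group `T` removes the unbounded generator
(`IsStrongSol.interaction`), and `y` solves an ordinary differential equation in a Banach space whose
right-hand side is Lipschitz on bounded sets. The Picard–Lindelöf theorem gives a Lipschitz flow on a
common time interval, and Grönwall's inequality gives uniqueness among all continuous solutions
(`exists_flow`).

*Analyticity.* The Fourier integral of an element of `G^{σ,r}` converges locally uniformly in the
tube, together with its derivative (`analyticInTube_synth`).
-/

namespace GevreyNLW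

noncomputable section

open scoped BoundedContinuousFunction Real NNReal Convolution ContDiff ComplexConjugate

/-! ### Semilinear evolution equations with a bounded group -/

section Abstract

theorem continuous_of_lipschitzOnWith_closedBall
    {E : Type*} [NormedAddCommGroup E] {N : E → E}
    (hN : ∀ R : ℝ, ∃ K : ℝ≥0, LipschitzOnWith K N (Metric.closedBall 0 R)) : Continuous N := by
  refine continuous_iff_continuousAt.2 fun x => ?_
  obtain ⟨K, hK⟩ := hN (‖x‖ + 1)
  refine hK.continuousOn.continuousAt ?_
  refine mem_of_superset (Metric.ball_mem_nhds x one_pos) fun y hy => ?_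
  rw [mem_closedBall_zero_iff]
  have := norm_sub_norm_le y x
  rw [mem_ball_iff_norm] at hy
  linarith

variable {E F : Type*} [NormedAddCommGroup E] [NormedSpace ℝ E]
  [NormedAddCommGroup F] [NormedSpace ℝ F]

/-- If every `ℓ i ∘ Y` has derivative `ℓ i ∘ R`, where the continuous linear maps `ℓ i` separate
points and `R` is continuous, then `Y` has derivative `R`: by the fundamental theorem of calculus
`Y t - Y 0 - ∫₀ᵗ R` is annihilated by all `ℓ i`. -/
theorem hasDerivWithinAt_of_separating {ι : Type*} [CompleteSpace E] (ℓ : ι → E →L[ℝ] F)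
    [CompleteSpace F]
    (hℓ : ∀ x, (∀ i, ℓ i x = 0) → x = 0) {δ : ℝ} {Y R : ℝ → E}
    (hR : ContinuousOn R (Ico 0 δ))
    (hd : ∀ i, ∀ t ∈ Ico 0 δ, HasDerivWithinAt (fun τ => ℓ i (Y τ)) (ℓ i (R t)) (Ico 0 δ) t) :
    ∀ t ∈ Ico 0 δ, HasDerivWithinAt Y (R t) (Ico 0 δ) t := by
  have hII : ∀ t ∈ Ico (0 : ℝ) δ, IntervalIntegrable R volume 0 t := fun t ht => by
    refine ContinuousOn.intervalIntegrable (hR.mono ?_)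
    rw [uIcc_of_le ht.1]
    exact fun x hx => ⟨hx.1, hx.2.trans_lt ht.2⟩
  have key : ∀ t ∈ Ico (0 : ℝ) δ, Y t = Y 0 + ∫ τ in (0 : ℝ)..t, R τ := by
    intro t ht
    rw [← sub_eq_iff_eq_add', ← sub_eq_zero]
    refine hℓ _ fun i => ?_
    have hsub : Icc 0 t ⊆ Ico 0 δ := fun x hx => ⟨hx.1, hx.2.trans_lt ht.2⟩
    have := intervalIntegral.integral_eq_sub_of_hasDeriv_right_of_le (a := 0) (b := t)
      (f := fun τ => ℓ i (Y τ)) (f' := fun τ => ℓ i (R τ)) ht.1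
      (fun x hx => (hd i x (hsub hx)).continuousWithinAt.mono hsub)
      (fun x hx => (hd i x (hsub ⟨hx.1.le, hx.2.le⟩)).mono_of_mem_nhdsWithin
        (mem_of_superset (Ioo_mem_nhdsGT (hx.2.trans ht.2))
          fun y hy => ⟨(hx.1.trans hy.1).le, hy.2⟩))
      (((ℓ i).continuous.comp_continuousOn (hR.mono hsub)).intervalIntegrable_of_Icc ht.1)
    rw [map_sub, map_sub, ← ContinuousLinearMap.intervalIntegral_comp_comm _ (hII t ht), this,
      sub_self]
  intro t ht
  have h1 : HasDerivWithinAt (fun x => Y 0 + ∫ τ in (0 : ℝ)..x, R τ) (R t) (Ico 0 δ) t := by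
    have hδ : 0 < δ := ht.1.trans_lt ht.2
    -- extend `R` continuously to the whole line from a compact interval around `t`
    obtain ⟨b, hb1, hb2⟩ := exists_between ht.2
    have hb0 : 0 ≤ b := ht.1.trans hb1.le
    have hRc : Continuous (IccExtend hb0 ((Icc 0 b).domRestrict R)) := by
      refine Continuous.Icc_extend' ?_
      exact (hR.mono fun x hx => ⟨hx.1, hx.2.trans_lt hb2⟩).domRestrict
    have h2 := (hRc.integral_hasStrictDerivAt 0 t).hasDerivAt.hasDerivWithinAt (s := Ico 0 δ)
    have hval : ∀ x ∈ Icc 0 b, IccExtend hb0 ((Icc 0 b).domRestrict R) x = R x := fun x hx => by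
      rw [IccExtend_of_mem hb0 _ hx]; rfl
    rw [hval t ⟨ht.1, hb1.le⟩] at h2
    refine (h2.const_add (Y 0)).congr_of_eventuallyEq ?_ ?_
    · have : Iio b ∈ 𝓝 t := Iio_mem_nhds hb1
      filter_upwards [mem_nhdsWithin_of_mem_nhds this, self_mem_nhdsWithin] with x hx hx'
      congr 1
      refine intervalIntegral.integral_congr fun y hy => ?_
      rw [uIcc_of_le hx'.1] at hy
      exact (hval y ⟨hy.1, hy.2.trans hx.le⟩).symm
    · congr 1
      refine intervalIntegral.integral_congr fun y hy => ?_
      rw [uIcc_of_le ht.1] at hy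
      exact (hval y ⟨hy.1, hy.2.trans hb1.le⟩).symm
  exact h1.congr key (key t ht)

/-- Product rule for `τ ↦ T τ (z τ)` where the operators `T τ` are uniformly bounded and only
strongly continuous. -/
theorem hasDerivWithinAt_strong_apply {T : ℝ → E →L[ℝ] F} {C : ℝ}
    (hb : ∀ t x, ‖T t x‖ ≤ C * ‖x‖) (hc : ∀ x, Continuous fun t => T t x)
    {z : ℝ → E} {z' : E} {w : F} {s : Set ℝ} {t : ℝ}
    (hz : HasDerivWithinAt z z' s t) (hT : HasDerivWithinAt (fun τ => T τ (z t)) w s t) :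
    HasDerivWithinAt (fun τ => T τ (z τ)) (w + T t z') s t := by
  rw [hasDerivWithinAt_iff_tendsto_slope] at hz hT ⊢
  have h1 : Tendsto (fun τ => T τ (slope z t τ - z')) (𝓝[s \ {t}] t) (𝓝 0) := by
    have h0 : Tendsto (fun τ => C * ‖slope z t τ - z'‖) (𝓝[s \ {t}] t) (𝓝 0) := by
      simpa using (tendsto_iff_norm_sub_tendsto_zero.1 hz).const_mul C
    exact squeeze_zero_norm (fun τ => hb _ _) h0
  have h2 : Tendsto (fun τ => T τ z') (𝓝[s \ {t}] t) (𝓝 (T t z')) :=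
    ((hc z').tendsto t).mono_left nhdsWithin_le_nhds
  have h3 := (hT.add h1).add h2
  rw [add_zero] at h3
  refine h3.congr fun τ => ?_
  simp only [slope_def_module, map_sub, map_smul, smul_sub]
  abel

theorem continuousOn_strong_apply {T : ℝ → E →L[ℝ] F} {C : ℝ}
    (hb : ∀ t x, ‖T t x‖ ≤ C * ‖x‖) (hc : ∀ x, Continuous fun t => T t x)
    {z : ℝ → E} {s : Set ℝ} (hz : ContinuousOn z s) :
    ContinuousOn (fun τ => T τ (z τ)) s := by
  intro t ht
  have h1 : Tendsto (fun τ => T τ (z τ - z t)) (𝓝[s] t) (𝓝 0) := by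
    have h0 : Tendsto (fun τ => C * ‖z τ - z t‖) (𝓝[s] t) (𝓝 0) := by
      simpa using (tendsto_iff_norm_sub_tendsto_zero.1 (hz t ht)).const_mul C
    exact squeeze_zero_norm (fun τ => hb _ _) h0
  have h2 : Tendsto (fun τ => T τ (z t)) (𝓝[s] t) (𝓝 (T t (z t))) :=
    ((hc _).tendsto t).mono_left nhdsWithin_le_nhds
  have h3 := h1.add h2
  rw [zero_add] at h3
  refine h3.congr fun τ => ?_
  simp

/-- `T` is a strongly continuous bounded group on `E` whose generator is the (possibly unbounded)
operator `M⁻¹ A`, where the bounded operators `M`, `A` commute with `T` and `M` is injective.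
The role of `M` is to make the domain of the generator the range of `M`. -/
structure IsGroupGeneratedBy (T : ℝ → E →L[ℝ] E) (M A : E →L[ℝ] E) (C : ℝ) : Prop where
  zero : ∀ x, T 0 x = x
  neg : ∀ t x, T t (T (-t) x) = x
  bound : ∀ t x, ‖T t x‖ ≤ C * ‖x‖
  cont : ∀ x, Continuous fun t => T t x
  comm_M : ∀ t x, T t (M x) = M (T t x)
  comm_A : ∀ t x, T t (A x) = A (T t x)
  deriv : ∀ x t, HasDerivAt (fun τ => T τ (M x)) (T t (A x)) t
  inj : ∀ x, M x = 0 → x = 0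

/-- `z` is a continuous solution on `[0, δ)` of `z' = M⁻¹ A z + N z`, the equation being understood
after application of `M`. -/
structure IsStrongSol (M A : E →L[ℝ] E) (N : E → E) (δ : ℝ) (z : ℝ → E) : Prop where
  cont : ContinuousOn z (Ico 0 δ)
  deriv : ∀ t ∈ Ico 0 δ, HasDerivWithinAt (fun τ => M (z τ)) (A (z t) + M (N (z t))) (Ico 0 δ) t

variable {T : ℝ → E →L[ℝ] E} {M A : E →L[ℝ] E} {C : ℝ} {N : E → E} {δ : ℝ}

/-- In the interaction picture `y(t) = T(-t) z(t)` the unbounded generator disappears: `y` solves an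
ordinary differential equation in `E`. -/
theorem IsStrongSol.interaction [CompleteSpace E] (hT : IsGroupGeneratedBy T M A C)
    (hN : Continuous N) {z : ℝ → E} (hz : IsStrongSol M A N δ z) :
    ∀ t ∈ Ico 0 δ, HasDerivWithinAt (fun τ => T (-τ) (z τ))
      (T (-t) (N (T t (T (-t) (z t))))) (Ico 0 δ) t := by
  have hb : ∀ t x, ‖T (-t) x‖ ≤ C * ‖x‖ := fun t x => hT.bound _ _
  have hc : ∀ x, Continuous fun t => T (-t) x := fun x => (hT.cont x).comp continuous_neg
  refine hasDerivWithinAt_of_separating (fun _ : Unit => M) (fun x hx => hT.inj x (hx ()))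
    (R := fun t => T (-t) (N (T t (T (-t) (z t))))) ?_ ?_
  · simp_rw [hT.neg]
    exact continuousOn_strong_apply hb hc (hN.comp_continuousOn hz.cont)
  · rintro - t ht
    have h1 : HasDerivWithinAt (fun τ => T (-τ) (M (z t))) (-T (-t) (A (z t))) (Ico 0 δ) t := by
      have := (hT.deriv (z t) (-t)).scomp t (hasDerivAt_neg t)
      simpa [Function.comp_def] using this.hasDerivWithinAt
    have h2 := hasDerivWithinAt_strong_apply hb hc (hz.deriv t ht) h1
    rw [hT.neg]
    simp only [map_add, hT.comm_M] at h2
    simpa using h2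

/-- Converse of `IsStrongSol.interaction`. -/
theorem isStrongSol_of_interaction (hT : IsGroupGeneratedBy T M A C) {y : ℝ → E}
    (hy : ∀ t ∈ Ico 0 δ, HasDerivWithinAt y (T (-t) (N (T t (y t)))) (Ico 0 δ) t) :
    IsStrongSol M A N δ fun t => T t (y t) where
  cont := continuousOn_strong_apply hT.bound hT.cont fun t ht => (hy t ht).continuousWithinAt
  deriv t ht := by
    have h1 := (hT.deriv (y t) t).hasDerivWithinAt (s := Ico 0 δ)
    have h2 := hasDerivWithinAt_strong_apply (z := fun τ => M (y τ)) hT.bound hT.cont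
      (M.hasFDerivAt.comp_hasDerivWithinAt t (hy t ht)) h1
    simp only [hT.comm_M, hT.neg, hT.comm_A] at h2
    exact h2

/-- Local well-posedness of `z' = M⁻¹ A z + N z` in the class of all continuous solutions, when `N`
is Lipschitz on bounded sets. -/
theorem exists_flow [CompleteSpace E] (hT : IsGroupGeneratedBy T M A C)
    (hN : ∀ R : ℝ, ∃ K : ℝ≥0, LipschitzOnWith K N (Metric.closedBall 0 R)) (z₀ : E) :
    ∃ δ > 0, ∃ ρ > 0, ∃ Φ : E → ℝ → E, ∃ L : ℝ,
      (∀ z ∈ Metric.closedBall z₀ ρ, IsStrongSol M A N δ (Φ z) ∧ Φ z 0 = z ∧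
        ∀ w, IsStrongSol M A N δ w → w 0 = z → ∀ t ∈ Ico 0 δ, w t = Φ z t) ∧
      ∀ z ∈ Metric.closedBall z₀ ρ, ∀ z' ∈ Metric.closedBall z₀ ρ, ∀ t ∈ Ico 0 δ,
        ‖Φ z t - Φ z' t‖ ≤ L * ‖z - z'‖ := by
  have hNc := continuous_of_lipschitzOnWith_closedBall hN
  obtain ⟨C', hC'0, hCC'⟩ : ∃ C' : ℝ≥0, 0 < C' ∧ C ≤ C' :=
    ⟨C.toNNReal + 1, by positivity, by
      push_cast; linarith [Real.le_coe_toNNReal C]⟩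
  have hb : ∀ t x, ‖T t x‖ ≤ C' * ‖x‖ := fun t x =>
    (hT.bound t x).trans (mul_le_mul_of_nonneg_right hCC' (norm_nonneg x))
  set v : ℝ → E → E := fun t y => T (-t) (N (T t y)) with hv
  -- the interaction vector field is Lipschitz on bounded sets, uniformly in time
  have hvL : ∀ R : ℝ, ∃ K : ℝ≥0, ∀ t, LipschitzOnWith K (v t) (Metric.closedBall 0 R) := by
    intro R
    obtain ⟨K, hK⟩ := hN (C' * R)
    refine ⟨C' * K * C', fun t => LipschitzOnWith.of_dist_le_mul fun x hx y hy => ?_⟩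
    have hmem : ∀ x ∈ Metric.closedBall (0 : E) R, T t x ∈ Metric.closedBall (0 : E) (C' * R) := by
      intro x hx
      rw [mem_closedBall_zero_iff] at hx ⊢
      exact (hb t x).trans (by gcongr)
    have h1 := hK.dist_le_mul _ (hmem x hx) _ (hmem y hy)
    rw [dist_eq_norm, dist_eq_norm, ← map_sub] at h1
    rw [dist_eq_norm, dist_eq_norm, hv]
    simp only
    rw [← map_sub]
    calc _ ≤ C' * ‖N (T t x) - N (T t y)‖ := hb _ _
      _ ≤ C' * (K * (C' * ‖x - y‖)) := by
        gcongr
        exact h1.trans (by gcongr; exact hb _ _)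
      _ = _ := by push_cast; ring
  have hvc : ∀ x, Continuous fun t => v t x := fun x => by
    have h1 : ContinuousOn (fun t => N (T t x)) univ :=
      (hNc.comp (hT.cont x)).continuousOn
    have := continuousOn_strong_apply (T := fun t => T (-t)) (fun t x => hT.bound _ _)
      (fun x => (hT.cont x).comp continuous_neg) h1
    exact continuousOn_univ.1 this
  obtain ⟨K, hK⟩ := hvL (‖z₀‖ + 1)
  obtain ⟨B, hB⟩ : ∃ B : ℝ≥0, ∀ t, ∀ x ∈ Metric.closedBall z₀ 1, ‖v t x‖ ≤ B := by
    refine ⟨C' * ‖N 0‖₊ + K * (‖z₀‖₊ + 1), fun t x hx => ?_⟩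
    have hx0 : ‖x‖ ≤ ‖z₀‖ + 1 := by
      have := norm_sub_norm_le x z₀
      rw [mem_closedBall_iff_norm] at hx
      linarith
    have h0 : (0 : E) ∈ Metric.closedBall (0 : E) (‖z₀‖ + 1) :=
      Metric.mem_closedBall_self (by positivity)
    have h1 := (hK t).dist_le_mul x (by simpa using hx0) 0 h0
    rw [dist_eq_norm, dist_zero_right] at h1
    have h2 : ‖v t 0‖ ≤ C' * ‖N 0‖ := by
      simp only [hv, map_zero]
      exact hb _ _
    have h3 : ‖v t x‖ ≤ ‖v t 0‖ + ‖v t x - v t 0‖ := norm_le_norm_add_norm_sub' _ _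
    have h4 : (K : ℝ) * ‖x‖ ≤ K * (‖z₀‖ + 1) := by gcongr
    push_cast
    linarith
  set δ : ℝ := 1 / (2 * (B + 1)) with hδ
  have hδ0 : 0 < δ := by positivity
  have hPL : IsPicardLindelof v (tmin := 0) (tmax := δ) ⟨0, le_rfl, hδ0.le⟩ z₀ 1 (1 / 2) B K := by
    refine ⟨fun t _ => (hK t).mono ?_, fun x _ => (hvc x).continuousOn, fun t _ x hx => hB t x hx, ?_⟩
    · intro x hx
      have := norm_sub_norm_le x z₀
      simp only [NNReal.coe_one, mem_closedBall_iff_norm, sub_zero] at hx ⊢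
      linarith
    · have h1 : (B : ℝ) * δ ≤ 1 / 2 := by
        rw [hδ, mul_one_div, div_le_iff₀ (by positivity)]
        linarith
      simp only [sub_zero, sub_self, max_eq_left hδ0.le]
      push_cast
      linarith
  obtain ⟨α, hα, L, hL⟩ :=
    hPL.exists_forall_mem_closedBall_eq_hasDerivWithinAt_lipschitzOnWith
  have hsub : Ico (0 : ℝ) δ ⊆ Icc 0 δ := Ico_subset_Icc_self
  refine ⟨δ, hδ0, 1 / 2, by positivity, fun z t => T t (α z t), C' * L, fun z hz => ?_, ?_⟩
  · obtain ⟨h0, hd⟩ := hα z (by simpa using hz)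
    have hd' : ∀ t ∈ Ico 0 δ, HasDerivWithinAt (α z) (v t (α z t)) (Ico 0 δ) t :=
      fun t ht => (hd t (hsub ht)).mono hsub
    simp only at h0
    refine ⟨isStrongSol_of_interaction hT hd', by simp only [hT.zero, h0], fun w hw hw0 t ht => ?_⟩
    -- on `[0, t]` both trajectories stay in a bounded set
    have hwd := hw.interaction hT hNc
    have hsub' : Icc 0 t ⊆ Ico 0 δ := fun x hx => ⟨hx.1, hx.2.trans_lt ht.2⟩
    have hright : ∀ {f : ℝ → E} {f' : E} {x : ℝ}, x ∈ Ico 0 t →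
        HasDerivWithinAt f f' (Ico 0 δ) x → HasDerivWithinAt f f' (Ici x) x := by
      intro f f' x hx h
      exact h.mono_of_mem_nhdsWithin (mem_of_superset (Ico_mem_nhdsGE (hx.2.trans ht.2))
        fun y hy => ⟨hx.1.trans hy.1, hy.2⟩)
    have hc1 : ContinuousOn (fun τ => T (-τ) (w τ)) (Icc 0 t) :=
      fun x hx => (hwd x (hsub' hx)).continuousWithinAt.mono hsub'
    have hc2 : ContinuousOn (α z) (Icc 0 t) :=
      fun x hx => (hd' x (hsub' hx)).continuousWithinAt.mono hsub'
    obtain ⟨R1, hR1⟩ := isCompact_Icc.exists_bound_of_continuousOn hc1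
    obtain ⟨R2, hR2⟩ := isCompact_Icc.exists_bound_of_continuousOn hc2
    obtain ⟨K', hK'⟩ := hvL (max R1 R2)
    have := ODE_solution_unique_of_mem_Icc_right (v := v)
      (s := fun _ => Metric.closedBall 0 (max R1 R2)) (fun t _ => hK' t) hc1
      (fun x hx => hright hx (hwd x (hsub' (Ico_subset_Icc_self hx))))
      (fun x hx => by
        rw [mem_closedBall_zero_iff]
        exact (hR1 x (Ico_subset_Icc_self hx)).trans (le_max_left _ _)) hc2
      (fun x hx => hright hx (hd' x (hsub' (Ico_subset_Icc_self hx))))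
      (fun x hx => by
        rw [mem_closedBall_zero_iff]
        exact (hR2 x (Ico_subset_Icc_self hx)).trans (le_max_right _ _))
      (by simp only [neg_zero, hT.zero, hw0, h0])
    have h2 := this ⟨ht.1, le_rfl⟩
    simp only at h2 ⊢
    rw [← h2, hT.neg]
  · intro z hz z' hz' t ht
    have := (hL t (hsub ht)).dist_le_mul z (by simpa using hz) z' (by simpa using hz')
    rw [dist_eq_norm, dist_eq_norm] at this
    simp only
    rw [← map_sub, mul_assoc]
    exact (hb _ _).trans (by gcongr)

end Abstract

variable {d : ℕ}

/-! ### Bounded multiplication operators on `L²` -/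

theorem memLp_bounded_mul (m : Space d →ᵇ ℂ) (g : L2 d) :
    MemLp (fun ξ => m ξ * g ξ) 2 volume :=
  (Lp.memLp g).of_le_mul (c := ‖m‖)
    (m.continuous.aestronglyMeasurable.mul (Lp.aestronglyMeasurable g)) <| by
      refine Eventually.of_forall fun ξ => ?_
      rw [norm_mul]
      exact mul_le_mul_of_nonneg_right (m.norm_coe_le_norm ξ) (norm_nonneg _)

/-- Multiplication of square integrable functions by a bounded continuous function. -/
def mulOp (m : Space d →ᵇ ℂ) : L2 d →L[ℂ] L2 d :=
  LinearMap.mkContinuous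
    { toFun := fun g => (memLp_bounded_mul m g).toLp
      map_add' := fun f g => by
        rw [← MemLp.toLp_add, MemLp.toLp_eq_toLp_iff]
        filter_upwards [Lp.coeFn_add f g] with ξ h
        rw [h, Pi.add_apply, Pi.add_apply, mul_add]
      map_smul' := fun c f => by
        rw [RingHom.id_apply, ← MemLp.toLp_const_smul, MemLp.toLp_eq_toLp_iff]
        filter_upwards [Lp.coeFn_smul c f] with ξ h
        rw [h, Pi.smul_apply, Pi.smul_apply, smul_eq_mul, smul_eq_mul, mul_left_comm] }
    ‖m‖ fun g => by
      refine Lp.norm_le_mul_norm_of_ae_le_mul ?_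
      filter_upwards [(memLp_bounded_mul m g).coeFn_toLp] with ξ h
      refine (congrArg norm h).trans_le ?_
      rw [norm_mul]
      exact mul_le_mul_of_nonneg_right (m.norm_coe_le_norm ξ) (norm_nonneg _)

theorem coeFn_mulOp (m : Space d →ᵇ ℂ) (g : L2 d) : mulOp m g =ᵐ[volume] fun ξ => m ξ * g ξ :=
  (memLp_bounded_mul m g).coeFn_toLp

theorem norm_mulOp_le (m : Space d →ᵇ ℂ) (g : L2 d) : ‖mulOp m g‖ ≤ ‖m‖ * ‖g‖ := by
  refine Lp.norm_le_mul_norm_of_ae_le_mul ?_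
  filter_upwards [coeFn_mulOp m g] with ξ h
  rw [h, norm_mul]
  exact mul_le_mul_of_nonneg_right (m.norm_coe_le_norm ξ) (norm_nonneg _)

theorem mulOp_mulOp (m n : Space d →ᵇ ℂ) (g : L2 d) : mulOp m (mulOp n g) = mulOp (m * n) g := by
  ext1
  filter_upwards [coeFn_mulOp m (mulOp n g), coeFn_mulOp n g, coeFn_mulOp (m * n) g]
    with ξ h1 h2 h3
  rw [h1, h2, h3, BoundedContinuousFunction.mul_apply, mul_assoc]

theorem mulOp_add (m n : Space d →ᵇ ℂ) (g : L2 d) : mulOp (m + n) g = mulOp m g + mulOp n g := by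
  ext1
  filter_upwards [coeFn_mulOp m g, coeFn_mulOp n g, coeFn_mulOp (m + n) g,
    Lp.coeFn_add (mulOp m g) (mulOp n g)] with ξ h1 h2 h3 h4
  rw [h3, h4, Pi.add_apply, h1, h2, BoundedContinuousFunction.add_apply, add_mul]

theorem mulOp_sub (m n : Space d →ᵇ ℂ) (g : L2 d) : mulOp (m - n) g = mulOp m g - mulOp n g := by
  rw [eq_sub_iff_add_eq, ← mulOp_add, sub_add_cancel]

theorem mulOp_smul (c : ℝ) (m : Space d →ᵇ ℂ) (g : L2 d) : mulOp (c • m) g = c • mulOp m g := by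
  ext1
  filter_upwards [coeFn_mulOp m g, coeFn_mulOp (c • m) g, Lp.coeFn_smul c (mulOp m g)]
    with ξ h1 h2 h3
  rw [h2, h3, Pi.smul_apply, h1, BoundedContinuousFunction.coe_smul, smul_mul_assoc]

theorem mulOp_one (g : L2 d) : mulOp 1 g = g := by
  ext1
  filter_upwards [coeFn_mulOp 1 g] with ξ h1
  simp [h1]

theorem mulOp_injective {m : Space d →ᵇ ℂ} (hm : ∀ ξ, m ξ ≠ 0) : Function.Injective (mulOp m) := by
  intro f g h
  ext1
  filter_upwards [coeFn_mulOp m f, coeFn_mulOp m g] with ξ h1 h2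
  rw [h, h2] at h1
  exact (mul_left_cancel₀ (hm ξ) h1).symm

/-- Dominated convergence for multiplication operators. -/
theorem tendsto_mulOp {ι : Type*} {l : Filter ι} [l.IsCountablyGenerated] {m : ι → Space d →ᵇ ℂ}
    {n : Space d →ᵇ ℂ} {C : ℝ} (hC : ∀ᶠ i in l, ∀ ξ, ‖m i ξ‖ ≤ C)
    (h : ∀ ξ, Tendsto (fun i => m i ξ) l (𝓝 (n ξ))) (g : L2 d) :
    Tendsto (fun i => mulOp (m i) g) l (𝓝 (mulOp n g)) := by
  rcases l.eq_or_neBot with rfl | hl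
  · exact tendsto_bot
  have hn : ∀ ξ, ‖n ξ‖ ≤ C := fun ξ =>
    le_of_tendsto (h ξ).norm (hC.mono fun i hi => hi ξ)
  rw [Lp.tendsto_Lp_iff_tendsto_eLpNorm']
  have h2 : (2 : ℝ≥0∞) ≠ 0 := by norm_num
  have hsq : Tendsto (fun i => ∫⁻ ξ, ‖(m i ξ - n ξ) * g ξ‖ₑ ^ (2 : ℝ)) l (𝓝 0) := by
    have hg : ∫⁻ ξ, ‖g ξ‖ₑ ^ (2 : ℝ) ≠ ⊤ := by
      have := (eLpNorm_lt_top_iff_lintegral_rpow_enorm_lt_top h2 ENNReal.ofNat_ne_top).1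
        (Lp.memLp g).2
      simpa using this.ne
    have := tendsto_lintegral_filter_of_dominated_convergence (l := l) (μ := (volume : Measure (Space d)))
      (F := fun i ξ => ‖(m i ξ - n ξ) * g ξ‖ₑ ^ (2 : ℝ)) (f := fun _ => 0)
      (fun ξ => ENNReal.ofReal (2 * C) ^ (2 : ℝ) * ‖g ξ‖ₑ ^ (2 : ℝ)) ?_ ?_ ?_ ?_
    · simpa using this
    · refine Eventually.of_forall fun i => ?_
      have h0 : Measurable fun ξ => m i ξ - n ξ :=
        ((m i).continuous.sub n.continuous).measurable
      exact ((h0.mul (Lp.stronglyMeasurable g).measurable).enorm).pow_const _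
    · filter_upwards [hC] with i hi
      refine Eventually.of_forall fun ξ => ?_
      rw [enorm_mul, ENNReal.mul_rpow_of_nonneg _ _ (by norm_num)]
      gcongr
      rw [← ofReal_norm]
      refine ENNReal.ofReal_le_ofReal ((norm_sub_le _ _).trans ?_)
      linarith [hi ξ, hn ξ]
    · have h8 : ENNReal.ofReal (2 * C) ^ (2 : ℝ) ≠ ⊤ :=
        ENNReal.rpow_ne_top_of_nonneg (by norm_num) ENNReal.ofReal_ne_top
      rw [lintegral_const_mul' _ _ h8]
      exact ENNReal.mul_ne_top h8 hg
    · refine Eventually.of_forall fun ξ => ?_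
      have h1 : Tendsto (fun i => (m i ξ - n ξ) * g ξ) l (𝓝 0) := by
        simpa using ((h ξ).sub_const (n ξ)).mul_const (g ξ)
      have h3 := h1.enorm
      rw [enorm_zero] at h3
      have h4 := (ENNReal.continuous_rpow_const (y := 2)).tendsto 0 |>.comp h3
      simpa [Function.comp_def] using h4
  have h5 := (ENNReal.continuous_rpow_const (y := 1 / 2)).tendsto 0 |>.comp hsq
  simp only [Function.comp_def] at h5
  rw [ENNReal.zero_rpow_of_pos (by norm_num)] at h5
  refine h5.congr fun i => ?_
  rw [eLpNorm_eq_lintegral_rpow_enorm_toReal h2 ENNReal.ofNat_ne_top]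
  simp only [ENNReal.toReal_ofNat]
  congr 1
  refine lintegral_congr_ae ?_
  filter_upwards [coeFn_mulOp (m i) g, coeFn_mulOp n g] with ξ h6 h7
  rw [Pi.sub_apply, h6, h7, sub_mul]

/-! ### Weights and the Gevrey spaces -/

/-- The bracket `(1 + |2 π ζ|²)^{1/2}`, i.e. `⟨ξ⟩` at the angular frequency `ξ = 2 π ζ`. Here `ζ` is
the argument of Mathlib's Fourier transform. -/
def bracket (ζ : Space d) : ℝ := Real.sqrt (1 + (2 * π * ‖ζ‖) ^ 2)

/-- The weight `e^{σ|ξ|} ⟨ξ⟩^r` at `ξ = 2 π ζ`. -/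
def weight (σ r : ℝ) (ζ : Space d) : ℝ := Real.exp (2 * π * σ * ‖ζ‖) * bracket ζ ^ r

theorem one_le_bracket (ζ : Space d) : 1 ≤ bracket ζ := by
  rw [bracket, Real.one_le_sqrt]
  nlinarith [sq_nonneg (2 * π * ‖ζ‖)]

theorem bracket_pos (ζ : Space d) : 0 < bracket ζ := one_pos.trans_le (one_le_bracket ζ)

theorem bracket_sq (ζ : Space d) : bracket ζ ^ 2 = 1 + (2 * π * ‖ζ‖) ^ 2 :=
  Real.sq_sqrt (by positivity)

theorem continuous_bracket : Continuous (bracket : Space d → ℝ) := by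
  unfold bracket; fun_prop

theorem continuous_bracket_rpow (r : ℝ) : Continuous fun ζ : Space d => bracket ζ ^ r :=
  continuous_bracket.rpow_const fun ζ => Or.inl (bracket_pos ζ).ne'

theorem bracket_le (ζ : Space d) : bracket ζ ≤ 1 + 2 * π * ‖ζ‖ := by
  rw [bracket, Real.sqrt_le_left (by positivity)]
  nlinarith [show 0 ≤ 2 * π * ‖ζ‖ by positivity]

theorem weight_pos (σ r : ℝ) (ζ : Space d) : 0 < weight σ r ζ :=
  mul_pos (Real.exp_pos _) (Real.rpow_pos_of_pos (bracket_pos ζ) _)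

theorem continuous_weight (σ r : ℝ) : Continuous (weight σ r : Space d → ℝ) := by
  unfold weight
  exact (by fun_prop : Continuous fun ζ : Space d => Real.exp (2 * π * σ * ‖ζ‖)).mul
    (continuous_bracket_rpow r)

theorem weight_add (σ r r' : ℝ) (ζ : Space d) :
    weight σ (r + r') ζ = weight σ r ζ * bracket ζ ^ r' := by
  rw [weight, weight, Real.rpow_add (bracket_pos ζ)]
  ring

theorem weight_exp_add (σ σ' r : ℝ) (ζ : Space d) :
    weight (σ + σ') r ζ = Real.exp (2 * π * σ' * ‖ζ‖) * weight σ r ζ := by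
  rw [weight, weight, ← mul_assoc, ← Real.exp_add]
  congr 2
  ring

/-- The weight is bounded below for every real `r`, since exponentials dominate powers. -/
theorem exists_inv_weight_le {σ : ℝ} (hσ : 0 < σ) (r : ℝ) :
    ∃ C : ℝ, ∀ ζ : Space d, (weight σ r ζ)⁻¹ ≤ C := by
  set R : ℝ := max (-r) 0 with hR
  -- `K` is chosen so that `1 + y ≤ K e^{y/K}` gives `(1 + y)^R ≤ K^R e^{σ y}`
  set K : ℝ := max 1 (R / σ) with hK
  have hK1 : 1 ≤ K := le_max_left _ _
  have hR0 : 0 ≤ R := le_max_right _ _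
  refine ⟨K ^ R, fun ζ => ?_⟩
  set y : ℝ := 2 * π * ‖ζ‖ with hy
  have hy0 : 0 ≤ y := by positivity
  have h1 : bracket ζ ^ (-r) ≤ K ^ R * Real.exp (σ * y) := by
    calc bracket ζ ^ (-r) ≤ bracket ζ ^ R :=
          Real.rpow_le_rpow_of_exponent_le (one_le_bracket ζ) (le_max_left _ _)
      _ ≤ (K * Real.exp (y / K)) ^ R := by
          refine Real.rpow_le_rpow (bracket_pos ζ).le ?_ hR0
          have h2 := Real.add_one_le_exp (y / K)
          have h3 : K * (y / K + 1) = y + K := by field_simp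
          have h4 := bracket_le ζ
          nlinarith [mul_le_mul_of_nonneg_left h2 (by linarith : 0 ≤ K)]
      _ = K ^ R * Real.exp (y / K * R) := by
          rw [Real.mul_rpow (by linarith) (Real.exp_pos _).le, ← Real.exp_mul]
      _ ≤ _ := by
          refine mul_le_mul_of_nonneg_left (Real.exp_le_exp.2 ?_) (by positivity)
          rw [div_mul_eq_mul_div, div_le_iff₀ (by linarith)]
          have : R ≤ σ * K := by
            have := le_max_right 1 (R / σ)
            rw [div_le_iff₀ hσ] at this
            linarith
          nlinarith
  rw [weight, mul_inv, ← Real.rpow_neg (bracket_pos ζ).le, ← Real.exp_neg]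
  calc _ ≤ Real.exp (-(2 * π * σ * ‖ζ‖)) * (K ^ R * Real.exp (σ * y)) := by gcongr
    _ = K ^ R * (Real.exp (-(2 * π * σ * ‖ζ‖)) * Real.exp (σ * y)) := by ring
    _ = K ^ R := by
      rw [← Real.exp_add, hy, show -(2 * π * σ * ‖ζ‖) + σ * (2 * π * ‖ζ‖) = 0 by ring,
        Real.exp_zero, mul_one]

/-- `⟨ξ⟩^{-m} ∈ L²` for `m > d/2`. -/
theorem memLp_bracket_rpow_neg {m : ℝ} (hm : (d : ℝ) / 2 < m) :
    MemLp (fun ζ : Space d => bracket ζ ^ (-m)) 2 volume := by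
  have hm0 : 0 < m := lt_of_le_of_lt (by positivity) hm
  rw [memLp_two_iff_integrable_sq (continuous_bracket_rpow _).aestronglyMeasurable]
  have h := integrable_rpow_neg_one_add_norm_sq (E := Space d) (μ := volume) (r := 2 * m)
    (by rw [finrank_euclideanSpace_fin]; linarith)
  refine h.mono' ((continuous_bracket_rpow _).pow 2).aestronglyMeasurable
    (Eventually.of_forall fun ζ => ?_)
  rw [Real.norm_of_nonneg (by positivity), ← Real.rpow_natCast, ← Real.rpow_mul (bracket_pos ζ).le,
    bracket, Real.sqrt_eq_rpow, ← Real.rpow_mul (by positivity),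
    show (1 / 2 * (-m * ((2 : ℕ) : ℝ))) = -(2 * m) / 2 by push_cast; ring]
  refine Real.rpow_le_rpow_of_nonpos (by positivity) ?_ (by linarith)
  have : 1 ≤ 2 * π := by linarith [Real.pi_gt_three]
  gcongr
  exact le_mul_of_one_le_left (norm_nonneg _) this

theorem memLp_inv_weight {σ : ℝ} (hσ : 0 < σ) (r : ℝ) :
    MemLp (fun ζ : Space d => (weight σ r ζ)⁻¹) 2 volume := by
  obtain ⟨C, hC⟩ := exists_inv_weight_le (d := d) hσ (r - (d + 1))
  have hm : (d : ℝ) / 2 < d + 1 := by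
    have : (0 : ℝ) ≤ d := by positivity
    linarith
  refine ((memLp_bracket_rpow_neg hm).const_mul C).mono'
    ((continuous_weight σ r).inv₀ fun ζ => (weight_pos σ r ζ).ne').aestronglyMeasurable
    (Eventually.of_forall fun ζ => ?_)
  have h1 : weight σ r ζ = weight σ (r - (d + 1)) ζ * bracket ζ ^ ((d : ℝ) + 1) := by
    rw [← weight_add]; ring_nf
  rw [Real.norm_of_nonneg (inv_nonneg.2 (weight_pos σ r ζ).le), h1, mul_inv,
    ← Real.rpow_neg (bracket_pos ζ).le]
  exact mul_le_mul_of_nonneg_right (hC ζ) (Real.rpow_nonneg (bracket_pos ζ).le _)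

/-- A continuous function `Space d → ℝ` with `|m| ≤ C`, as a bounded continuous complex-valued
function. -/
def realMul (m : Space d → ℝ) (hm : Continuous m) (C : ℝ) (hC : ∀ ζ, |m ζ| ≤ C) : Space d →ᵇ ℂ :=
  BoundedContinuousFunction.ofNormedAddCommGroup (fun ζ => (m ζ : ℂ))
    (Complex.continuous_ofReal.comp hm) C fun ζ => by
      rw [Complex.norm_real]; exact hC ζ

@[simp] theorem realMul_apply (m : Space d → ℝ) (hm : Continuous m) (C : ℝ) (hC : ∀ ζ, |m ζ| ≤ C)
    (ζ : Space d) : realMul m hm C hC ζ = (m ζ : ℂ) := rfl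

/-- The multiplier `(e^{σ|ξ|} ⟨ξ⟩^r)⁻¹`. -/
def invWeight {σ : ℝ} (hσ : 0 < σ) (r : ℝ) : Space d →ᵇ ℂ :=
  realMul (fun ζ => (weight σ r ζ)⁻¹)
    ((continuous_weight σ r).inv₀ fun ζ => (weight_pos σ r ζ).ne')
    (exists_inv_weight_le hσ r).choose fun ζ => by
      rw [abs_of_nonneg (inv_nonneg.2 (weight_pos σ r ζ).le)]
      exact (exists_inv_weight_le hσ r).choose_spec ζ

theorem invWeight_apply {σ : ℝ} (hσ : 0 < σ) (r : ℝ) (ζ : Space d) :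
    invWeight hσ r ζ = (((weight σ r ζ)⁻¹ : ℝ) : ℂ) := rfl

theorem invWeight_ne_zero {σ : ℝ} (hσ : 0 < σ) (r : ℝ) (ζ : Space d) : invWeight hσ r ζ ≠ 0 := by
  rw [invWeight_apply]
  exact_mod_cast (inv_pos.2 (weight_pos σ r ζ)).ne'

/-- The isomorphism of `L²` onto `G^{σ,r}` (up to a scalar, an isometry) that divides by the weight
and inverts the Fourier transform. -/
def synth {σ : ℝ} (hσ : 0 < σ) (r : ℝ) : L2 d →L[ℂ] L2 d :=
  (FourierTransform.fourierInvCLM ℂ (L2 d)).comp (mulOp (invWeight hσ r))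

theorem synth_apply {σ : ℝ} (hσ : 0 < σ) (r : ℝ) (g : L2 d) :
    synth hσ r g = (𝓕⁻ (mulOp (invWeight hσ r) g) : L2 d) := rfl

theorem fourier_synth {σ : ℝ} (hσ : 0 < σ) (r : ℝ) (g : L2 d) :
    (𝓕 (synth hσ r g) : L2 d) = mulOp (invWeight hσ r) g := by
  rw [synth_apply, FourierTransform.fourier_fourierInv_eq]

theorem synth_injective {σ : ℝ} (hσ : 0 < σ) (r : ℝ) :
    Function.Injective (synth hσ r : L2 d → L2 d) := by
  intro f g h
  refine mulOp_injective (invWeight_ne_zero hσ r) ?_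
  rw [← fourier_synth, h, fourier_synth]

/-- The factor produced by the change of variables `ξ = 2 π ζ`. -/
def fourierScale (d : ℕ) : ℝ≥0∞ := ENNReal.ofReal ((2 * π) ^ d) ^ (1 / 2 : ℝ)

theorem fourierScale_ne_zero : fourierScale d ≠ 0 := by
  rw [fourierScale, Ne, ENNReal.rpow_eq_zero_iff_of_pos (by norm_num), ENNReal.ofReal_eq_zero, not_le]
  positivity

theorem fourierScale_ne_top : fourierScale d ≠ ⊤ :=
  ENNReal.rpow_ne_top_of_nonneg (by norm_num) ENNReal.ofReal_ne_top

theorem gevreyNorm_eq (σ r : ℝ) (f : L2 d) :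
    gevreyNorm σ r f =
      fourierScale d * eLpNorm (fun ζ => (weight σ r ζ : ℂ) * (𝓕 f : L2 d) ζ) 2 volume := by
  have h2 : (2 : ℝ≥0∞) ≠ 0 := by norm_num
  rw [eLpNorm_eq_lintegral_rpow_enorm_toReal h2 ENNReal.ofNat_ne_top, gevreyNorm, fourierScale,
    ENNReal.toReal_ofNat, ← ENNReal.mul_rpow_of_nonneg _ _ (by norm_num)]
  congr 1
  set G : Space d → ℝ≥0∞ := fun ζ => ‖(weight σ r ζ : ℂ) * (𝓕 f : L2 d) ζ‖ₑ ^ (2 : ℝ) with hG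
  have hGm : Measurable G := by
    have h1 : Measurable fun ζ : Space d => (weight σ r ζ : ℂ) :=
      (Complex.continuous_ofReal.comp (continuous_weight σ r)).measurable
    exact ((h1.mul (Lp.stronglyMeasurable _).measurable).enorm).pow_const _
  have hπ : (2 * π)⁻¹ ≠ 0 := by positivity
  have h3 : ∫⁻ ξ : Space d, G ((2 * π)⁻¹ • ξ) = ENNReal.ofReal ((2 * π) ^ d) * ∫⁻ ζ, G ζ := by
    rw [← lintegral_map hGm (measurable_const_smul _), Measure.map_addHaar_smul _ hπ,
      lintegral_smul_measure, finrank_euclideanSpace_fin, inv_pow, inv_inv,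
      abs_of_nonneg (by positivity), smul_eq_mul]
  rw [← h3]
  refine lintegral_congr fun ξ => ?_
  have h4 : 2 * π * ‖(2 * π)⁻¹ • ξ‖ = ‖ξ‖ := by
    rw [norm_smul, Real.norm_of_nonneg (by positivity)]
    field_simp
  have h5 : Real.exp (2 * σ * ‖ξ‖) * (1 + ‖ξ‖ ^ 2) ^ r = weight σ r ((2 * π)⁻¹ • ξ) ^ 2 := by
    rw [weight, bracket, mul_pow, h4, ← Real.exp_nat_mul, Real.sqrt_eq_rpow,
      ← Real.rpow_mul (by positivity), ← Real.rpow_natCast ((1 + ‖ξ‖ ^ 2) ^ (1 / 2 * r)) 2,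
      ← Real.rpow_mul (by positivity)]
    congr 2
    · rw [← h4]; push_cast; ring
    · push_cast; ring
  rw [hG, h5]
  simp only
  rw [enorm_mul, ENNReal.mul_rpow_of_nonneg _ _ (by norm_num), ENNReal.rpow_ofNat,
    ENNReal.rpow_ofNat, ENNReal.ofReal_pow (weight_pos _ _ _).le, hat]
  congr 2
  rw [← ofReal_norm, Complex.norm_real, Real.norm_of_nonneg (weight_pos _ _ _).le]

theorem gevreyNorm_synth {σ : ℝ} (hσ : 0 < σ) (r : ℝ) (g : L2 d) :
    gevreyNorm σ r (synth hσ r g) = fourierScale d * ‖g‖ₑ := by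
  rw [gevreyNorm_eq, fourier_synth, Lp.enorm_def]
  congr 1
  refine eLpNorm_congr_ae ?_
  filter_upwards [coeFn_mulOp (invWeight hσ r) g] with ζ h
  rw [h, invWeight_apply, ← mul_assoc, ← Complex.ofReal_mul, mul_inv_cancel₀ (weight_pos σ r ζ).ne',
    Complex.ofReal_one, one_mul]

theorem exists_synth_of_memGevrey {σ : ℝ} (hσ : 0 < σ) {r : ℝ} {f : L2 d} (hf : MemGevrey σ r f) :
    ∃ g, synth hσ r g = f := by
  rw [MemGevrey, gevreyNorm_eq] at hf
  have hm : MemLp (fun ζ => (weight σ r ζ : ℂ) * (𝓕 f : L2 d) ζ) 2 volume := by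
    refine ⟨(Complex.continuous_ofReal.comp (continuous_weight σ r)).aestronglyMeasurable.mul
      (Lp.aestronglyMeasurable _), ?_⟩
    by_contra h
    rw [not_lt, top_le_iff] at h
    rw [h, ENNReal.mul_top fourierScale_ne_zero] at hf
    exact lt_irrefl _ hf
  refine ⟨hm.toLp _, ?_⟩
  rw [synth_apply]
  have : mulOp (invWeight hσ r) (hm.toLp _) = (𝓕 f : L2 d) := by
    ext1
    filter_upwards [coeFn_mulOp (invWeight hσ r) (hm.toLp _), hm.coeFn_toLp] with ζ h1 h2
    rw [h1, h2, invWeight_apply, ← mul_assoc, ← Complex.ofReal_mul,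
      inv_mul_cancel₀ (weight_pos σ r ζ).ne', Complex.ofReal_one, one_mul]
  rw [this, FourierTransform.fourierInv_fourier_eq]

theorem memGevrey_synth {σ : ℝ} (hσ : 0 < σ) (r : ℝ) (g : L2 d) :
    MemGevrey σ r (synth hσ r g) := by
  rw [MemGevrey, gevreyNorm_synth]
  exact ENNReal.mul_lt_top fourierScale_ne_top.lt_top enorm_lt_top

theorem tendsto_gevreyNorm_synth {ι : Type*} {l : Filter ι} {σ : ℝ} (hσ : 0 < σ) (r : ℝ)
    {g : ι → L2 d} :
    Tendsto (fun i => gevreyNorm σ r (synth hσ r (g i))) l (𝓝 0) ↔ Tendsto g l (𝓝 0) := by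
  simp_rw [gevreyNorm_synth]
  rw [tendsto_zero_iff_enorm_tendsto_zero]
  constructor
  · intro h
    have h1 := ENNReal.Tendsto.const_mul (a := (fourierScale d)⁻¹) h
      (Or.inr (ENNReal.inv_ne_top.2 fourierScale_ne_zero))
    simpa [← mul_assoc, ENNReal.inv_mul_cancel fourierScale_ne_zero fourierScale_ne_top] using h1
  · intro h
    simpa using ENNReal.Tendsto.const_mul (a := fourierScale d) h (Or.inr fourierScale_ne_top)

/-! ### The Klein–Gordon group -/

/-- The multiplier `⟨ξ⟩⁻¹`. -/
def invBracket : Space d →ᵇ ℂ :=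
  realMul (fun ζ => (bracket ζ)⁻¹) (continuous_bracket.inv₀ fun ζ => (bracket_pos ζ).ne') 1
    fun ζ => by
      rw [abs_of_nonneg (inv_nonneg.2 (bracket_pos ζ).le)]
      exact inv_le_one_of_one_le₀ (one_le_bracket ζ)

/-- The multiplier `cos (t ⟨ξ⟩)`. -/
def cosMul (t : ℝ) : Space d →ᵇ ℂ :=
  realMul (fun ζ => Real.cos (t * bracket ζ))
    (Real.continuous_cos.comp (continuous_const.mul continuous_bracket)) 1
    fun _ => Real.abs_cos_le_one _

/-- The multiplier `sin (t ⟨ξ⟩)`. -/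
def sinMul (t : ℝ) : Space d →ᵇ ℂ :=
  realMul (fun ζ => Real.sin (t * bracket ζ))
    (Real.continuous_sin.comp (continuous_const.mul continuous_bracket)) 1
    fun _ => Real.abs_sin_le_one _

theorem invBracket_apply (ζ : Space d) : invBracket ζ = (((bracket ζ)⁻¹ : ℝ) : ℂ) := rfl

theorem cosMul_apply (t : ℝ) (ζ : Space d) :
    cosMul t ζ = ((Real.cos (t * bracket ζ) : ℝ) : ℂ) := rfl

theorem sinMul_apply (t : ℝ) (ζ : Space d) :
    sinMul t ζ = ((Real.sin (t * bracket ζ) : ℝ) : ℂ) := rfl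

theorem norm_cosMul_apply_le (t : ℝ) (ζ : Space d) : ‖cosMul t ζ‖ ≤ 1 := by
  rw [cosMul_apply, Complex.norm_real]; exact Real.abs_cos_le_one _

theorem norm_sinMul_apply_le (t : ℝ) (ζ : Space d) : ‖sinMul t ζ‖ ≤ 1 := by
  rw [sinMul_apply, Complex.norm_real]; exact Real.abs_sin_le_one _

theorem norm_mulOp_cosMul_le (t : ℝ) (g : L2 d) : ‖mulOp (cosMul t) g‖ ≤ ‖g‖ :=
  (norm_mulOp_le _ _).trans <| mul_le_of_le_one_left (norm_nonneg _) <|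
    (BoundedContinuousFunction.norm_le zero_le_one).2 (norm_cosMul_apply_le t)

theorem norm_mulOp_sinMul_le (t : ℝ) (g : L2 d) : ‖mulOp (sinMul t) g‖ ≤ ‖g‖ :=
  (norm_mulOp_le _ _).trans <| mul_le_of_le_one_left (norm_nonneg _) <|
    (BoundedContinuousFunction.norm_le zero_le_one).2 (norm_sinMul_apply_le t)

/-- Differentiation in a parameter of a multiplier that is Lipschitz in the parameter with constant
`⟨ξ⟩`, on the range of multiplication by `⟨ξ⟩⁻¹`. -/
theorem hasDerivAt_mulOp_invBracket {m : ℝ → Space d →ᵇ ℂ} {n : Space d →ᵇ ℂ} {t : ℝ}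
    (hm : ∀ τ ζ, ‖m τ ζ - m t ζ‖ ≤ |τ - t| * bracket ζ)
    (hd : ∀ ζ, HasDerivAt (fun τ => m τ ζ) (n ζ * (bracket ζ : ℂ)) t) (x : L2 d) :
    HasDerivAt (fun τ => mulOp (m τ) (mulOp invBracket x)) (mulOp n x) t := by
  rw [hasDerivAt_iff_tendsto_slope]
  have hslope : ∀ τ, slope (fun τ => mulOp (m τ) (mulOp invBracket x)) t τ
      = mulOp ((τ - t)⁻¹ • ((m τ - m t) * invBracket)) x := by
    intro τ
    rw [slope_def_module, mulOp_smul, ← mulOp_mulOp, mulOp_sub]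
  refine Tendsto.congr (fun τ => (hslope τ).symm) ?_
  have hval : ∀ τ ζ, ((τ - t)⁻¹ • ((m τ - m t) * invBracket) : Space d →ᵇ ℂ) ζ
      = (τ - t)⁻¹ • ((m τ ζ - m t ζ) * invBracket ζ) := fun τ ζ => rfl
  refine tendsto_mulOp (C := 1) (Eventually.of_forall fun τ ζ => ?_) (fun ζ => ?_) x
  · rw [hval, norm_smul, norm_mul, invBracket_apply, Complex.norm_real,
      Real.norm_of_nonneg (inv_nonneg.2 (bracket_pos ζ).le), norm_inv, Real.norm_eq_abs]
    have h0 := (bracket_pos ζ)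
    rcases eq_or_ne τ t with rfl | hne
    · simp
    · have h1 : 0 < |τ - t| := abs_pos.2 (sub_ne_zero.2 hne)
      calc _ ≤ |τ - t|⁻¹ * ((|τ - t| * bracket ζ) * (bracket ζ)⁻¹) := by
            gcongr; exact hm τ ζ
        _ = 1 := by field_simp
  · have h1 := (hasDerivAt_iff_tendsto_slope.1 (hd ζ)).mul_const (invBracket ζ)
    have h2 : (bracket ζ : ℂ) ≠ 0 := by exact_mod_cast (bracket_pos ζ).ne'
    rw [invBracket_apply, Complex.ofReal_inv, mul_assoc, mul_inv_cancel₀ h2, mul_one,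
      ← Complex.ofReal_inv, ← invBracket_apply] at h1
    refine h1.congr fun τ => ?_
    rw [hval, slope_def_module, smul_mul_assoc]

theorem hasDerivAt_mulOp_cosMul (x : L2 d) (t : ℝ) :
    HasDerivAt (fun τ => mulOp (cosMul τ) (mulOp invBracket x)) (-mulOp (sinMul t) x) t := by
  have h : mulOp (-sinMul t) x = -mulOp (sinMul t) x := by
    have := mulOp_smul (-1) (sinMul t) x
    simpa using this
  rw [← h]
  refine hasDerivAt_mulOp_invBracket (fun τ ζ => ?_) (fun ζ => ?_) x
  · rw [cosMul_apply, cosMul_apply, ← Complex.ofReal_sub, Complex.norm_real]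
    have := Real.abs_cos_sub_cos_le (τ * bracket ζ) (t * bracket ζ)
    rwa [← sub_mul, abs_mul, abs_of_pos (bracket_pos ζ)] at this
  · have h1 := (((hasDerivAt_id t).mul_const (bracket ζ)).cos).ofReal_comp
    convert! h1 using 1
    rw [BoundedContinuousFunction.neg_apply, sinMul_apply]
    simp

theorem hasDerivAt_mulOp_sinMul (x : L2 d) (t : ℝ) :
    HasDerivAt (fun τ => mulOp (sinMul τ) (mulOp invBracket x)) (mulOp (cosMul t) x) t := by
  refine hasDerivAt_mulOp_invBracket (fun τ ζ => ?_) (fun ζ => ?_) x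
  · rw [sinMul_apply, sinMul_apply, ← Complex.ofReal_sub, Complex.norm_real]
    have := Real.abs_sin_sub_sin_le (τ * bracket ζ) (t * bracket ζ)
    rwa [← sub_mul, abs_mul, abs_of_pos (bracket_pos ζ)] at this
  · have h1 := (((hasDerivAt_id t).mul_const (bracket ζ)).sin).ofReal_comp
    convert! h1 using 1
    rw [cosMul_apply]
    simp

theorem continuous_mulOp_cosMul (x : L2 d) : Continuous fun t => mulOp (cosMul t) x :=
  continuous_iff_continuousAt.2 fun t =>
    tendsto_mulOp (Eventually.of_forall fun τ ζ => norm_cosMul_apply_le τ ζ) (fun ζ => by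
      simp_rw [cosMul_apply]
      exact (by fun_prop : Continuous fun τ : ℝ => ((Real.cos (τ * bracket ζ) : ℝ) : ℂ)).tendsto t) x

theorem continuous_mulOp_sinMul (x : L2 d) : Continuous fun t => mulOp (sinMul t) x :=
  continuous_iff_continuousAt.2 fun t =>
    tendsto_mulOp (Eventually.of_forall fun τ ζ => norm_sinMul_apply_le τ ζ) (fun ζ => by
      simp_rw [sinMul_apply]
      exact (by fun_prop : Continuous fun τ : ℝ => ((Real.sin (τ * bracket ζ) : ℝ) : ℂ)).tendsto t) x

/-- The group of `U' = ⟨ξ⟩ V`, `V' = -⟨ξ⟩ U`: rotation by the angle `t ⟨ξ⟩`. -/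
def rotation (t : ℝ) : L2 d × L2 d →L[ℝ] L2 d × L2 d :=
  (((mulOp (cosMul t)).restrictScalars ℝ).comp (.fst ℝ _ _) +
      ((mulOp (sinMul t)).restrictScalars ℝ).comp (.snd ℝ _ _)).prod
    (((mulOp (cosMul t)).restrictScalars ℝ).comp (.snd ℝ _ _) -
      ((mulOp (sinMul t)).restrictScalars ℝ).comp (.fst ℝ _ _))

/-- Multiplication of both components by `⟨ξ⟩⁻¹`. -/
def regularizer : L2 d × L2 d →L[ℝ] L2 d × L2 d :=
  ((mulOp invBracket).restrictScalars ℝ).prodMap ((mulOp invBracket).restrictScalars ℝ)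

/-- The quarter turn `(U, V) ↦ (V, -U)`. -/
def quarterTurn : L2 d × L2 d →L[ℝ] L2 d × L2 d :=
  (ContinuousLinearMap.snd ℝ _ _).prod (-ContinuousLinearMap.fst ℝ _ _)

theorem rotation_apply (t : ℝ) (z : L2 d × L2 d) : rotation t z =
    (mulOp (cosMul t) z.1 + mulOp (sinMul t) z.2, mulOp (cosMul t) z.2 - mulOp (sinMul t) z.1) :=
  rfl

theorem regularizer_apply (z : L2 d × L2 d) :
    regularizer z = (mulOp invBracket z.1, mulOp invBracket z.2) := rfl

theorem quarterTurn_apply (z : L2 d × L2 d) : quarterTurn z = (z.2, -z.1) := rfl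

theorem mulOp_comm (m n : Space d →ᵇ ℂ) (g : L2 d) :
    mulOp m (mulOp n g) = mulOp n (mulOp m g) := by
  rw [mulOp_mulOp, mulOp_mulOp, mul_comm]

theorem isGroupGeneratedBy_rotation :
    IsGroupGeneratedBy (rotation (d := d)) regularizer quarterTurn 2 where
  zero x := by
    have h1 : cosMul 0 = (1 : Space d →ᵇ ℂ) := by ext ζ; simp [cosMul_apply]
    have h2 : mulOp (sinMul 0) = (0 : L2 d →L[ℂ] L2 d) := by
      have : sinMul 0 = (0 : ℝ) • (1 : Space d →ᵇ ℂ) := by ext ζ; simp [sinMul_apply]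
      ext1 g
      rw [this, mulOp_smul, zero_smul]; rfl
    rw [rotation_apply, h1, h2, mulOp_one, mulOp_one]
    simp
  neg t x := by
    have hc : cosMul (-t) = (cosMul t : Space d →ᵇ ℂ) := by ext ζ; simp [cosMul_apply]
    have hs : ∀ g : L2 d, mulOp (sinMul (-t)) g = -mulOp (sinMul t) g := by
      intro g
      have : sinMul (-t) = (-1 : ℝ) • (sinMul t : Space d →ᵇ ℂ) := by ext ζ; simp [sinMul_apply]
      rw [this, mulOp_smul, neg_one_smul]
    have hid : ∀ g : L2 d, mulOp (cosMul t) (mulOp (cosMul t) g) +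
        mulOp (sinMul t) (mulOp (sinMul t) g) = g := by
      intro g
      rw [mulOp_mulOp, mulOp_mulOp, ← mulOp_add]
      convert mulOp_one g using 2
      congr 1
      ext ζ
      simp only [BoundedContinuousFunction.add_apply, BoundedContinuousFunction.mul_apply,
        cosMul_apply, sinMul_apply, BoundedContinuousFunction.coe_one, Pi.one_apply]
      norm_cast
      nlinarith [Real.sin_sq_add_cos_sq (t * bracket ζ)]
    rw [rotation_apply, rotation_apply, hc, hs, hs]
    ext1
    · simp only [map_add, map_sub, map_neg]
      rw [mulOp_comm (sinMul t) (cosMul t)]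
      conv_rhs => rw [← hid x.1]
      abel
    · simp only [map_add, map_sub, map_neg]
      rw [mulOp_comm (sinMul t) (cosMul t)]
      conv_rhs => rw [← hid x.2]
      abel
  bound t x := by
    have h1 := norm_fst_le x
    have h2 := norm_snd_le x
    rw [rotation_apply, Prod.norm_def]
    refine max_le ?_ ?_
    · exact (norm_add_le _ _).trans (by
        linarith [norm_mulOp_cosMul_le t x.1, norm_mulOp_sinMul_le t x.2])
    · exact (norm_sub_le _ _).trans (by
        linarith [norm_mulOp_cosMul_le t x.2, norm_mulOp_sinMul_le t x.1])
  cont x := by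
    simp_rw [rotation_apply]
    exact ((continuous_mulOp_cosMul _).add (continuous_mulOp_sinMul _)).prodMk
      ((continuous_mulOp_cosMul _).sub (continuous_mulOp_sinMul _))
  comm_M t x := by
    simp only [rotation_apply, regularizer_apply, map_add, map_sub, mulOp_comm invBracket]
  comm_A t x := by
    simp only [rotation_apply, quarterTurn_apply, map_neg]
    ext1 <;> simp only <;> abel
  deriv x t := by
    simp only [rotation_apply, quarterTurn_apply, regularizer_apply]
    have h := ((hasDerivAt_mulOp_cosMul x.1 t).add (hasDerivAt_mulOp_sinMul x.2 t)).prodMk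
      ((hasDerivAt_mulOp_cosMul x.2 t).sub (hasDerivAt_mulOp_sinMul x.1 t))
    convert! h using 1
    ext1 <;> simp only [map_neg] <;> abel
  inj x h := by
    have h0 : ∀ ζ : Space d, invBracket ζ ≠ 0 := fun ζ => by
      rw [invBracket_apply]
      exact_mod_cast (inv_pos.2 (bracket_pos ζ)).ne'
    rw [regularizer_apply, Prod.mk_eq_zero] at h
    ext1
    · exact mulOp_injective h0 (h.1.trans (map_zero _).symm)
    · exact mulOp_injective h0 (h.2.trans (map_zero _).symm)

theorem synth_mulOp_invBracket {σ : ℝ} (hσ : 0 < σ) (r : ℝ) (g : L2 d) :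
    synth hσ r (mulOp invBracket g) = synth hσ (r + 1) g := by
  rw [synth_apply, synth_apply, mulOp_mulOp]
  congr 3
  ext ζ
  rw [BoundedContinuousFunction.mul_apply, invWeight_apply, invWeight_apply, invBracket_apply,
    weight_add, Real.rpow_one]
  push_cast
  rw [mul_inv]

/-! ### Convolution in weighted `L²` spaces -/

theorem bracket_add_le (η θ : Space d) : bracket (η + θ) ≤ bracket η + bracket θ := by
  have hη := bracket_sq η
  have hθ := bracket_sq θ
  have h1 := bracket_pos η
  have h2 := bracket_pos θ
  rw [bracket, Real.sqrt_le_left (by positivity)]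
  have h3 : 2 * π * ‖η + θ‖ ≤ 2 * π * ‖η‖ + 2 * π * ‖θ‖ := by
    rw [← mul_add]; gcongr; exact norm_add_le _ _
  have h4 : (2 * π * ‖η‖) ≤ bracket η := Real.le_sqrt_of_sq_le (by linarith)
  have h5 : (2 * π * ‖θ‖) ≤ bracket θ := Real.le_sqrt_of_sq_le (by linarith)
  have h6 : 0 ≤ 2 * π * ‖η‖ := by positivity
  have h7 : 0 ≤ 2 * π * ‖θ‖ := by positivity
  have h8 : (2 * π * ‖η + θ‖) ^ 2 ≤ (2 * π * ‖η‖ + 2 * π * ‖θ‖) ^ 2 := by gcongr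
  nlinarith [mul_le_mul h4 h5 h7 h1.le]

theorem bracket_neg (ζ : Space d) : bracket (-ζ) = bracket ζ := by
  rw [bracket, bracket, norm_neg]

/-- The two larger among three frequencies that sum to zero are comparable, so that a nonpositive
total power of them is controlled by the smallest. -/
theorem rpow_mul_rpow_mul_rpow_le {x y z α β γ : ℝ} (hz : 0 < z) (hzx : z ≤ x) (hzy : z ≤ y)
    (hx : x ≤ y + z) (hy : y ≤ x + z) (hαβ : α + β ≤ 0) :
    x ^ α * y ^ β * z ^ γ ≤ 2 ^ |α| * z ^ (α + β + γ) := by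
  have hx0 : 0 < x := hz.trans_le hzx
  have hy0 : 0 < y := hz.trans_le hzy
  have h1 : x ^ α ≤ 2 ^ |α| * y ^ α := by
    rcases le_total 0 α with h | h
    · rw [abs_of_nonneg h, ← Real.mul_rpow zero_le_two hy0.le]
      exact Real.rpow_le_rpow hx0.le (by linarith) h
    · rw [abs_of_nonpos h, Real.rpow_neg zero_le_two, ← Real.inv_rpow zero_le_two,
        ← Real.mul_rpow (by norm_num) hy0.le]
      exact Real.rpow_le_rpow_of_nonpos (by positivity) (by linarith) h
  calc x ^ α * y ^ β * z ^ γ ≤ 2 ^ |α| * y ^ α * y ^ β * z ^ γ := by gcongr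
    _ = 2 ^ |α| * y ^ (α + β) * z ^ γ := by rw [Real.rpow_add hy0]; ring
    _ ≤ 2 ^ |α| * z ^ (α + β) * z ^ γ := by
      have := Real.rpow_le_rpow_of_nonpos hz hzy hαβ
      have hzγ : 0 ≤ z ^ γ := by positivity
      exact mul_le_mul_of_nonneg_right (mul_le_mul_of_nonneg_left this (by positivity)) hzγ
    _ = _ := by rw [Real.rpow_add hz (α + β)]; ring

/-- The kernel of the product law is controlled by the bracket of the smallest of the three
frequencies. The conditions say that each pair of the exponents `-c`, `a`, `b` has a nonnegative
sum. -/
theorem bracket_kernel_le {a b c : ℝ} (hac : c ≤ a) (hbc : c ≤ b) (hab : 0 ≤ a + b) :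
    ∃ K : ℝ, 0 ≤ K ∧ ∀ η θ : Space d,
      bracket (η + θ) ^ c * (bracket η ^ a)⁻¹ * (bracket θ ^ b)⁻¹ ≤
        K * (bracket (η + θ) ^ (-(a + b - c)) + bracket η ^ (-(a + b - c)) +
          bracket θ ^ (-(a + b - c))) := by
  refine ⟨2 ^ |a| + 2 ^ |c|, by positivity, fun η θ => ?_⟩
  rw [← Real.rpow_neg (bracket_pos η).le, ← Real.rpow_neg (bracket_pos θ).le]
  have hX := bracket_pos (η + θ)
  have hA := bracket_pos η
  have hB := bracket_pos θ
  have t1 := bracket_add_le η θ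
  have t2 : bracket η ≤ bracket (η + θ) + bracket θ := by
    have := bracket_add_le (η + θ) (-θ)
    rwa [bracket_neg, add_neg_cancel_right] at this
  have t3 : bracket θ ≤ bracket (η + θ) + bracket η := by
    have := bracket_add_le (η + θ) (-η)
    rwa [bracket_neg, add_neg_cancel_comm] at this
  generalize bracket (η + θ) = X at *
  generalize bracket η = A at *
  generalize bracket θ = B at *
  set m := a + b - c with hm
  have pX : 0 ≤ X ^ (-m) := by positivity
  have pA : 0 ≤ A ^ (-m) := by positivity
  have pB : 0 ≤ B ^ (-m) := by positivity
  have q1 : (0 : ℝ) ≤ 2 ^ |a| := by positivity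
  have q2 : (0 : ℝ) ≤ 2 ^ |c| := by positivity
  have hcase : (X ≤ A ∧ X ≤ B) ∨ (A ≤ X ∧ A ≤ B) ∨ (B ≤ X ∧ B ≤ A) := by
    grind
  rcases hcase with ⟨h1, h2⟩ | ⟨h1, h2⟩ | ⟨h1, h2⟩
  · have := rpow_mul_rpow_mul_rpow_le (α := -a) (β := -b) (γ := c) hX h1 h2 (by linarith)
      (by linarith) (by linarith)
    rw [abs_neg, show -a + -b + c = -m by rw [hm]; ring] at this
    nlinarith
  · have := rpow_mul_rpow_mul_rpow_le (α := c) (β := -b) (γ := -a) hA h1 h2 (by linarith)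
      (by linarith) (by linarith)
    rw [show c + -b + -a = -m by rw [hm]; ring] at this
    nlinarith
  · have := rpow_mul_rpow_mul_rpow_le (α := c) (β := -a) (γ := -b) hB h1 h2 (by linarith)
      (by linarith) (by linarith)
    rw [show c + -a + -b = -m by rw [hm]; ring] at this
    nlinarith

section Lintegral

variable {α : Type*} [MeasurableSpace α] {μ : Measure α}

theorem lintegral_mul_sq_le {f g : α → ℝ≥0∞} (hf : AEMeasurable f μ) (hg : AEMeasurable g μ) :
    (∫⁻ x, f x * g x ∂μ) ^ 2 ≤ (∫⁻ x, f x ^ 2 ∂μ) * ∫⁻ x, g x ^ 2 ∂μ := by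
  have h := ENNReal.lintegral_mul_le_Lp_mul_Lq μ Real.HolderConjugate.two_two hf hg
  have h2 := pow_le_pow_left' h 2
  simp only [Pi.mul_apply] at h2
  refine h2.trans_eq ?_
  rw [mul_pow, ← ENNReal.rpow_natCast, ← ENNReal.rpow_natCast, ← ENNReal.rpow_mul,
    ← ENNReal.rpow_mul]
  norm_num

theorem lintegral_mul_sq_le_weighted {f g : α → ℝ≥0∞} (hf : AEMeasurable f μ)
    (hg : AEMeasurable g μ) :
    (∫⁻ x, f x * g x ∂μ) ^ 2 ≤ (∫⁻ x, f x ∂μ) * ∫⁻ x, f x * g x ^ 2 ∂μ := by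
  have hsq : ∀ x : ℝ≥0∞, (x ^ (1 / 2 : ℝ)) ^ 2 = x := fun x => by
    rw [← ENNReal.rpow_natCast, ← ENNReal.rpow_mul]; norm_num
  have h := lintegral_mul_sq_le (μ := μ) (hf.pow_const (1 / 2 : ℝ))
    ((hf.pow_const (1 / 2 : ℝ)).mul hg)
  simp only [Pi.mul_apply] at h
  simp_rw [mul_pow, hsq, ← mul_assoc, ← sq, hsq] at h
  exact h

theorem add_add_sq_le (x y z : ℝ≥0∞) : (x + y + z) ^ 2 ≤ 4 * (x ^ 2 + y ^ 2 + z ^ 2) := by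
  have h : ∀ u v : ℝ≥0∞, (u + v) ^ 2 ≤ 2 * (u ^ 2 + v ^ 2) := fun u v => by
    have := ENNReal.rpow_add_le_mul_rpow_add_rpow u v (p := 2) (by norm_num)
    norm_num at this
    exact this
  calc (x + y + z) ^ 2 ≤ 2 * ((x + y) ^ 2 + z ^ 2) := h _ _
    _ ≤ 2 * (2 * (x ^ 2 + y ^ 2) + 2 * z ^ 2) := by
      gcongr
      · exact h _ _
      · exact le_mul_of_one_le_left' (by norm_num)
    _ = _ := by ring

end Lintegral

/-- Young's inequality `L¹ * L² → L²`. -/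
theorem lintegral_conv_sq_le {f g : Space d → ℝ≥0∞} (hf : Measurable f) (hg : Measurable g) :
    ∫⁻ ξ, (∫⁻ η, f η * g (ξ - η)) ^ 2 ≤ (∫⁻ η, f η) ^ 2 * ∫⁻ η, g η ^ 2 := by
  calc _ ≤ ∫⁻ ξ, (∫⁻ η, f η) * ∫⁻ η, f η * g (ξ - η) ^ 2 := by
        refine lintegral_mono fun ξ => ?_
        exact lintegral_mul_sq_le_weighted hf.aemeasurable (by fun_prop)
    _ = (∫⁻ η, f η) * ∫⁻ ξ, ∫⁻ η, f η * g (ξ - η) ^ 2 :=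
        lintegral_const_mul _ (Measurable.lintegral_prod_right' (f := fun p : Space d × Space d =>
          f p.2 * g (p.1 - p.2) ^ 2) (by fun_prop))
    _ = (∫⁻ η, f η) * ∫⁻ η, ∫⁻ ξ, f η * g (ξ - η) ^ 2 := by
        rw [lintegral_lintegral_swap (by fun_prop)]
    _ = (∫⁻ η, f η) * ∫⁻ η, f η * ∫⁻ ξ, g ξ ^ 2 := by
        congr 1
        refine lintegral_congr fun η => ?_
        rw [lintegral_const_mul _ (by fun_prop), lintegral_sub_right_eq_self (fun ξ => g ξ ^ 2) η]
    _ = _ := by rw [lintegral_mul_const _ hf, sq, mul_assoc]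

/-- The convolution estimate behind the product law, for nonnegative functions. -/
theorem lintegral_kernel_conv_sq_le {k F G : Space d → ℝ≥0∞} (hk : Measurable k)
    (hF : Measurable F) (hG : Measurable G) :
    ∫⁻ ξ, (∫⁻ η, (k ξ + k η + k (ξ - η)) * (F η * G (ξ - η))) ^ 2 ≤
      12 * (∫⁻ η, k η ^ 2) * (∫⁻ η, F η ^ 2) * ∫⁻ η, G η ^ 2 := by
  set κ := ∫⁻ η, k η ^ 2
  set A := ∫⁻ η, F η ^ 2
  set B := ∫⁻ η, G η ^ 2
  have h1 : ∫⁻ ξ, (∫⁻ η, k ξ * (F η * G (ξ - η))) ^ 2 ≤ κ * (A * B) := by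
    calc _ ≤ ∫⁻ ξ, k ξ ^ 2 * (A * B) := by
          refine lintegral_mono fun ξ => ?_
          rw [lintegral_const_mul _ (by fun_prop), mul_pow]
          gcongr
          refine (lintegral_mul_sq_le hF.aemeasurable (by fun_prop)).trans_eq ?_
          rw [lintegral_sub_left_eq_self (fun η => G η ^ 2) ξ]
      _ = _ := lintegral_mul_const _ (by fun_prop)
  have h2 : ∫⁻ ξ, (∫⁻ η, k η * (F η * G (ξ - η))) ^ 2 ≤ κ * A * B := by
    simp_rw [← mul_assoc]
    refine (lintegral_conv_sq_le (hk.mul hF) hG).trans ?_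
    gcongr
    exact lintegral_mul_sq_le hk.aemeasurable hF.aemeasurable
  have h3 : ∫⁻ ξ, (∫⁻ η, k (ξ - η) * (F η * G (ξ - η))) ^ 2 ≤ κ * B * A := by
    have : ∀ ξ, ∫⁻ η, k (ξ - η) * (F η * G (ξ - η)) = ∫⁻ η, (k η * G η) * F (ξ - η) := by
      intro ξ
      rw [← lintegral_sub_left_eq_self (fun η => (k η * G η) * F (ξ - η)) ξ]
      refine lintegral_congr fun η => ?_
      rw [sub_sub_cancel]
      ring
    simp_rw [this]
    refine (lintegral_conv_sq_le (hk.mul hG) hF).trans ?_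
    gcongr
    exact lintegral_mul_sq_le hk.aemeasurable hG.aemeasurable
  have hm : ∀ u : Space d × Space d → ℝ≥0∞, Measurable u →
      Measurable fun ξ => (∫⁻ η, u (ξ, η)) ^ 2 := fun u hu =>
    (Measurable.lintegral_prod_right' hu).pow_const 2
  calc _ ≤ ∫⁻ ξ, 4 * ((∫⁻ η, k ξ * (F η * G (ξ - η))) ^ 2 + (∫⁻ η, k η * (F η * G (ξ - η))) ^ 2 +
        (∫⁻ η, k (ξ - η) * (F η * G (ξ - η))) ^ 2) := by
        refine lintegral_mono fun ξ => ?_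
        simp_rw [add_mul]
        rw [lintegral_add_right _ (by fun_prop), lintegral_add_right _ (by fun_prop)]
        exact add_add_sq_le _ _ _
    _ = 4 * ((∫⁻ ξ, (∫⁻ η, k ξ * (F η * G (ξ - η))) ^ 2) +
        (∫⁻ ξ, (∫⁻ η, k η * (F η * G (ξ - η))) ^ 2) +
        ∫⁻ ξ, (∫⁻ η, k (ξ - η) * (F η * G (ξ - η))) ^ 2) := by
        have m1 : Measurable fun ξ => (∫⁻ η, k ξ * (F η * G (ξ - η))) ^ 2 :=
          hm (fun p => k p.1 * (F p.2 * G (p.1 - p.2))) (by fun_prop)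
        have m2 : Measurable fun ξ => (∫⁻ η, k η * (F η * G (ξ - η))) ^ 2 :=
          hm (fun p => k p.2 * (F p.2 * G (p.1 - p.2))) (by fun_prop)
        have m3 : Measurable fun ξ => (∫⁻ η, k (ξ - η) * (F η * G (ξ - η))) ^ 2 :=
          hm (fun p => k (p.1 - p.2) * (F p.2 * G (p.1 - p.2))) (by fun_prop)
        rw [← lintegral_add_right _ m2, ← lintegral_add_right _ m3]
        exact lintegral_const_mul _ ((m1.add m2).add m3)
    _ ≤ 4 * (κ * (A * B) + κ * A * B + κ * B * A) := by gcongr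
    _ = _ := by ring

theorem lintegral_enorm_sq (g : L2 d) : ∫⁻ ξ, ‖g ξ‖ₑ ^ 2 = ‖g‖ₑ ^ 2 := by
  rw [Lp.enorm_def, eLpNorm_eq_lintegral_rpow_enorm_toReal (by norm_num) ENNReal.ofNat_ne_top,
    ← ENNReal.rpow_natCast, ← ENNReal.rpow_mul]
  norm_num

/-- The product law on the Fourier side: if `c ≤ a`, `c ≤ b`, `0 ≤ a + b` and `a + b - c > d/2`,
then convolution maps `L²(e^{σ|ξ|}⟨ξ⟩^a) × L²(e^{σ|ξ|}⟨ξ⟩^b)` to `L²(e^{σ|ξ|}⟨ξ⟩^c)`. The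
exponential weight is harmless because of the triangle inequality. -/
theorem eLpNorm_weight_convolution_le {σ : ℝ} (hσ : 0 < σ) {a b c : ℝ} (hac : c ≤ a) (hbc : c ≤ b)
    (hab : 0 ≤ a + b) (habc : (d : ℝ) / 2 < a + b - c) :
    ∃ C : ℝ≥0, ∀ g h : L2 d,
      eLpNorm (fun ξ => (weight σ c ξ : ℂ) *
        ((fun η => invWeight hσ a η * g η) ⋆[ContinuousLinearMap.mul ℂ ℂ]
          (fun η => invWeight hσ b η * h η)) ξ) 2 volume ≤ C * (‖g‖ₑ * ‖h‖ₑ) := by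
  obtain ⟨K, hK0, hK⟩ := bracket_kernel_le (d := d) hac hbc hab
  set k : Space d → ℝ≥0∞ := fun ζ => ENNReal.ofReal (bracket ζ ^ (-(a + b - c))) with hk
  have hkm : Measurable k := ENNReal.measurable_ofReal.comp (continuous_bracket_rpow _).measurable
  have hκ : ∫⁻ η, k η ^ 2 ≠ ⊤ := by
    have := (memLp_bracket_rpow_neg habc).2
    rw [eLpNorm_lt_top_iff_lintegral_rpow_enorm_lt_top (by norm_num) ENNReal.ofNat_ne_top] at this
    refine ne_of_eq_of_ne (lintegral_congr fun ζ => ?_) this.ne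
    rw [hk, ENNReal.toReal_ofNat, ENNReal.rpow_ofNat, Real.enorm_of_nonneg
      (Real.rpow_nonneg (bracket_pos ζ).le _)]
  set C2 : ℝ≥0∞ := ENNReal.ofReal K ^ 2 * (12 * ∫⁻ η, k η ^ 2) with hC2
  have hC2t : C2 ≠ ⊤ := ENNReal.mul_ne_top (by finiteness) (ENNReal.mul_ne_top (by simp) hκ)
  refine ⟨(C2 ^ (1 / 2 : ℝ)).toNNReal, fun g h => ?_⟩
  rw [ENNReal.coe_toNNReal (ENNReal.rpow_ne_top_of_nonneg (by norm_num) hC2t),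
    eLpNorm_eq_lintegral_rpow_enorm_toReal (by norm_num) ENNReal.ofNat_ne_top]
  have hroot : C2 ^ (1 / 2 : ℝ) * (‖g‖ₑ * ‖h‖ₑ) = (C2 * (‖g‖ₑ ^ 2 * ‖h‖ₑ ^ 2)) ^ (1 / 2 : ℝ) := by
    rw [ENNReal.mul_rpow_of_nonneg C2 _ (by norm_num), ← mul_pow,
      ← ENNReal.rpow_natCast (‖g‖ₑ * ‖h‖ₑ) 2, ← ENNReal.rpow_mul]
    norm_num
  rw [hroot, ENNReal.toReal_ofNat]
  refine ENNReal.rpow_le_rpow ?_ (by norm_num)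
  simp_rw [ENNReal.rpow_ofNat]
  have hgm : Measurable fun ξ => ‖g ξ‖ₑ := (Lp.stronglyMeasurable g).measurable.enorm
  have hhm : Measurable fun ξ => ‖h ξ‖ₑ := (Lp.stronglyMeasurable h).measurable.enorm
  have hpt : ∀ ξ η : Space d, weight σ c ξ * (weight σ a η)⁻¹ * (weight σ b (ξ - η))⁻¹ ≤
      K * (bracket ξ ^ (-(a + b - c)) + bracket η ^ (-(a + b - c)) +
        bracket (ξ - η) ^ (-(a + b - c))) := by
    intro ξ η
    have h1 := hK η (ξ - η)
    rw [add_sub_cancel] at h1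
    refine le_trans ?_ h1
    have h2 : Real.exp (2 * π * σ * ‖ξ‖) * (Real.exp (2 * π * σ * ‖η‖))⁻¹ *
        (Real.exp (2 * π * σ * ‖ξ - η‖))⁻¹ ≤ 1 := by
      rw [← Real.exp_neg, ← Real.exp_neg, ← Real.exp_add, ← Real.exp_add, Real.exp_le_one_iff]
      have h3 : ‖ξ‖ ≤ ‖η‖ + ‖ξ - η‖ := by
        simpa using norm_add_le η (ξ - η)
      have h4 : 0 ≤ 2 * π * σ := by positivity
      nlinarith
    have h5 : 0 ≤ bracket ξ ^ c * (bracket η ^ a)⁻¹ * (bracket (ξ - η) ^ b)⁻¹ := by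
      have := bracket_pos ξ; have := bracket_pos η; have := bracket_pos (ξ - η)
      positivity
    calc _ = (Real.exp (2 * π * σ * ‖ξ‖) * (Real.exp (2 * π * σ * ‖η‖))⁻¹ *
        (Real.exp (2 * π * σ * ‖ξ - η‖))⁻¹) *
          (bracket ξ ^ c * (bracket η ^ a)⁻¹ * (bracket (ξ - η) ^ b)⁻¹) := by
          simp only [weight, mul_inv]; ring
      _ ≤ _ := mul_le_of_le_one_left h5 h2
  have hen : ∀ r : ℝ, ∀ ζ : Space d, ‖invWeight hσ r ζ‖ₑ = ENNReal.ofReal (weight σ r ζ)⁻¹ :=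
    fun r ζ => by
      rw [invWeight_apply, ← ofReal_norm, Complex.norm_real,
        Real.norm_of_nonneg (inv_nonneg.2 (weight_pos σ r ζ).le)]
  calc _ ≤ ∫⁻ ξ, (ENNReal.ofReal K *
        ∫⁻ η, (k ξ + k η + k (ξ - η)) * (‖g η‖ₑ * ‖h (ξ - η)‖ₑ)) ^ 2 := by
        refine lintegral_mono fun ξ => ?_
        gcongr
        rw [enorm_mul, convolution]
        refine (mul_le_mul_right (enorm_integral_le_lintegral_enorm _) _).trans ?_
        rw [← lintegral_const_mul' _ _ enorm_ne_top, ← lintegral_const_mul' _ _ ENNReal.ofReal_ne_top]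
        refine lintegral_mono fun η => ?_
        rw [ContinuousLinearMap.mul_apply', enorm_mul, enorm_mul, enorm_mul, hen, hen,
          ← ofReal_norm (weight σ c ξ : ℂ), Complex.norm_real, Real.norm_of_nonneg (weight_pos _ _ _).le]
        have h6 := ENNReal.ofReal_le_ofReal (hpt ξ η)
        have := bracket_pos ξ; have := bracket_pos η; have := bracket_pos (ξ - η)
        have := weight_pos σ c ξ; have := weight_pos σ a η; have := weight_pos σ b (ξ - η)
        rw [ENNReal.ofReal_mul (by positivity), ENNReal.ofReal_mul (by positivity),
          ENNReal.ofReal_mul (by positivity), ENNReal.ofReal_add (by positivity) (by positivity),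
          ENNReal.ofReal_add (by positivity) (by positivity)] at h6
        calc _ = ENNReal.ofReal (weight σ c ξ) * ENNReal.ofReal (weight σ a η)⁻¹ *
            ENNReal.ofReal (weight σ b (ξ - η))⁻¹ * (‖g η‖ₑ * ‖h (ξ - η)‖ₑ) := by ring
          _ ≤ _ := by
            rw [← mul_assoc (ENNReal.ofReal K)]
            exact mul_le_mul_left h6 _
    _ = ENNReal.ofReal K ^ 2 * ∫⁻ ξ,
        (∫⁻ η, (k ξ + k η + k (ξ - η)) * (‖g η‖ₑ * ‖h (ξ - η)‖ₑ)) ^ 2 := by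
        simp_rw [mul_pow]
        rw [lintegral_const_mul' _ _ (by finiteness)]
    _ ≤ ENNReal.ofReal K ^ 2 * (12 * (∫⁻ η, k η ^ 2) * (∫⁻ η, ‖g η‖ₑ ^ 2) * ∫⁻ η, ‖h η‖ₑ ^ 2) := by
        gcongr
        exact lintegral_kernel_conv_sq_le hkm hgm hhm
    _ = _ := by rw [lintegral_enorm_sq, lintegral_enorm_sq, hC2]; ring

/-! ### Fourier representation, products and conjugates -/

theorem integral_fourierInv_mul_schwartz (f : L2 d) (ψ : 𝓢(Space d, ℂ)) :
    ∫ x, (𝓕⁻ f : L2 d) x * ψ x = ∫ ζ, f ζ * (𝓕⁻ ψ : 𝓢(Space d, ℂ)) ζ := by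
  have h := congrArg (fun T : 𝓢'(Space d, ℂ) => T ψ) (Lp.fourierInv_toTemperedDistribution_eq f)
  simp only [TemperedDistribution.fourierInv_apply, Lp.toTemperedDistribution_apply] at h
  simpa [mul_comm] using h.symm

theorem integral_fourierInv_fun_mul_schwartz {f : Space d → ℂ} (hf : Integrable f)
    (ψ : 𝓢(Space d, ℂ)) :
    ∫ x, 𝓕⁻ f x * ψ x = ∫ ζ, f ζ * (𝓕⁻ ψ : 𝓢(Space d, ℂ)) ζ := by
  have h := VectorFourier.integral_bilin_fourierIntegral_eq_flip (ContinuousLinearMap.mul ℂ ℂ)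
    (L := innerₗ (Space d)) (μ := volume) (ν := volume)
    Real.continuous_fourierChar continuous_inner hf.comp_neg ψ.integrable
  rw [Real.fourierInv_eq_fourier_comp_neg]
  simp only [ContinuousLinearMap.mul_apply', flip_innerₗ] at h
  refine h.trans ?_
  rw [← integral_neg_eq_self]
  refine integral_congr_ae (Eventually.of_forall fun ζ => ?_)
  simp only [neg_neg, SchwartzMap.fourierInv_coe, Real.fourierInv_eq_fourier_neg]
  rfl

/-- On `L¹ ∩ L²` the Plancherel transform is given by the Fourier integral. -/
theorem coeFn_fourierInv_ae_eq (f : L2 d) (hf : Integrable f) :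
    (𝓕⁻ f : L2 d) =ᵐ[volume] fun x => 𝓕⁻ (f : Space d → ℂ) x := by
  have hcont : Continuous (𝓕⁻ (f : Space d → ℂ)) := by
    rw [Real.fourierInv_eq_fourier_comp_neg]
    exact VectorFourier.fourierIntegral_continuous Real.continuous_fourierChar continuous_inner
      hf.comp_neg
  refine ae_eq_of_integral_contDiff_smul_eq
    ((Lp.memLp _).locallyIntegrable (by norm_num)) hcont.locallyIntegrable fun g hg hgs => ?_
  have hs : HasCompactSupport fun x => (g x : ℂ) := hgs.comp_left Complex.ofReal_zero
  have hd : ContDiff ℝ ∞ fun x => (g x : ℂ) := Complex.ofRealCLM.contDiff.comp hg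
  have h1 := integral_fourierInv_mul_schwartz f (hs.toSchwartzMap hd)
  rw [← integral_fourierInv_fun_mul_schwartz hf] at h1
  simpa [mul_comm] using h1

theorem integrable_invWeight_mul {σ : ℝ} (hσ : 0 < σ) (r : ℝ) (g : L2 d) :
    Integrable fun ζ => invWeight hσ r ζ * g ζ := by
  have h1 : MemLp (fun ζ : Space d => invWeight hσ r ζ) 2 volume := (memLp_inv_weight hσ r).ofReal
  exact h1.integrable_mul (Lp.memLp g)

/-- Elements of the Gevrey space are given by absolutely convergent Fourier integrals. -/
theorem synth_ae_eq {σ : ℝ} (hσ : 0 < σ) (r : ℝ) (g : L2 d) :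
    synth hσ r g =ᵐ[volume] 𝓕⁻ (fun ζ => invWeight hσ r ζ * g ζ) := by
  have h := coeFn_mulOp (invWeight hσ r) g
  have hi : Integrable (mulOp (invWeight hσ r) g : Space d → ℂ) :=
    (integrable_invWeight_mul hσ r g).congr h.symm
  filter_upwards [coeFn_fourierInv_ae_eq _ hi] with x hx
  rw [synth_apply, hx, Real.fourierInv_congr_ae h]

/-- The product law in the Gevrey spaces. -/
theorem exists_synth_mul {σ : ℝ} (hσ : 0 < σ) {a b c : ℝ} (hac : c ≤ a) (hbc : c ≤ b)
    (hab : 0 ≤ a + b) (habc : (d : ℝ) / 2 < a + b - c) :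
    ∃ C : ℝ≥0, ∀ g h : L2 d, ∃ k : L2 d,
      (synth hσ c k =ᵐ[volume] fun x => synth hσ a g x * synth hσ b h x) ∧
        ‖k‖ ≤ C * (‖g‖ * ‖h‖) := by
  obtain ⟨C, hC⟩ := eLpNorm_weight_convolution_le (d := d) hσ hac hbc hab habc
  refine ⟨C, fun g h => ?_⟩
  set φ : Space d → ℂ := fun η => invWeight hσ a η * g η with hφ
  set χ : Space d → ℂ := fun η => invWeight hσ b η * h η with hχ
  have iφ : Integrable φ := integrable_invWeight_mul hσ a g
  have iχ : Integrable χ := integrable_invWeight_mul hσ b h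
  have hint : Integrable (φ ⋆[ContinuousLinearMap.mul ℂ ℂ] χ) :=
    iφ.integrable_convolution _ iχ
  have hm : MemLp (fun ξ => (weight σ c ξ : ℂ) * (φ ⋆[ContinuousLinearMap.mul ℂ ℂ] χ) ξ) 2 volume :=
    ⟨(Complex.continuous_ofReal.comp (continuous_weight σ c)).aestronglyMeasurable.mul
      hint.aestronglyMeasurable, (hC g h).trans_lt (by finiteness)⟩
  refine ⟨hm.toLp _, ?_, ?_⟩
  · have h1 : (fun ζ => invWeight hσ c ζ * hm.toLp _ ζ) =ᵐ[volume]
        (φ ⋆[ContinuousLinearMap.mul ℂ ℂ] χ) := by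
      filter_upwards [hm.coeFn_toLp] with ζ hζ
      rw [hζ, invWeight_apply, ← mul_assoc, ← Complex.ofReal_mul,
        inv_mul_cancel₀ (weight_pos σ c ζ).ne', Complex.ofReal_one, one_mul]
    filter_upwards [synth_ae_eq hσ c (hm.toLp _), synth_ae_eq hσ a g, synth_ae_eq hσ b h]
      with x hx h2 h3
    rw [hx, h2, h3, Real.fourierInv_congr_ae h1, Real.fourierInv_eq_fourier_neg,
      Real.fourierInv_eq_fourier_neg, Real.fourierInv_eq_fourier_neg,
      Real.fourier_mul_convolution_eq iφ iχ]
  · have h2 := hC g h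
    rw [← Lp.enorm_toLp hm, ← ofReal_norm, ← ofReal_norm, ← ofReal_norm,
      ← ENNReal.ofReal_mul (norm_nonneg _), ← ENNReal.ofReal_coe_nnreal,
      ← ENNReal.ofReal_mul C.coe_nonneg, ENNReal.ofReal_le_ofReal_iff (by positivity)] at h2
    exact h2

theorem exists_synth_conj {σ : ℝ} (hσ : 0 < σ) (r : ℝ) (g : L2 d) :
    ∃ k : L2 d, (synth hσ r k =ᵐ[volume] fun x => conj (synth hσ r g x)) ∧ ‖k‖ = ‖g‖ := by
  have hneg := Measure.measurePreserving_neg (volume : Measure (Space d))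
  have hm1 : MemLp (fun ζ => g (-ζ)) 2 volume := (Lp.memLp g).comp_measurePreserving hneg
  have hm : MemLp (fun ζ => conj (g (-ζ))) 2 volume := hm1.star
  refine ⟨hm.toLp _, ?_, ?_⟩
  · filter_upwards [synth_ae_eq hσ r (hm.toLp _), synth_ae_eq hσ r g] with x hx h2
    have h1 : (fun ζ => invWeight hσ r ζ * hm.toLp _ ζ) =ᵐ[volume]
        fun ζ => invWeight hσ r ζ * conj (g (-ζ)) := by
      filter_upwards [hm.coeFn_toLp] with ζ hζ
      rw [hζ]
    rw [hx, h2, Real.fourierInv_congr_ae h1, Real.fourierInv_eq', Real.fourierInv_eq',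
      ← integral_conj, ← integral_neg_eq_self]
    refine integral_congr_ae (Eventually.of_forall fun ζ => ?_)
    have h3 : invWeight hσ r (-ζ) = invWeight hσ r ζ := by
      rw [invWeight_apply, invWeight_apply, weight, weight, bracket_neg, norm_neg]
    simp only [neg_neg, smul_eq_mul, map_mul, h3]
    rw [← Complex.exp_conj, invWeight_apply, Complex.conj_ofReal]
    congr 2
    simp [inner_neg_left, Complex.conj_ofNat]
  · rw [Lp.norm_toLp, Lp.norm_def]
    congr 1
    calc _ = eLpNorm (fun ζ => g (-ζ)) 2 volume :=
          eLpNorm_congr_norm_ae (Eventually.of_forall fun ζ => by simp)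
      _ = _ := eLpNorm_comp_measurePreserving (Lp.aestronglyMeasurable g) hneg

/-- Pairing of an element of the Gevrey space with a test function, on the Fourier side. -/
theorem integral_synth_mul_schwartz {σ : ℝ} (hσ : 0 < σ) (r : ℝ) (g : L2 d) (ψ : 𝓢(Space d, ℂ)) :
    ∫ x, synth hσ r g x * ψ x =
      ∫ ζ, invWeight hσ r ζ * g ζ * (𝓕⁻ ψ : 𝓢(Space d, ℂ)) ζ := by
  rw [synth_apply, integral_fourierInv_mul_schwartz]
  refine integral_congr_ae ?_
  filter_upwards [coeFn_mulOp (invWeight hσ r) g] with ζ hζ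
  rw [hζ]

/-! ### The power nonlinearity -/

/-- The monomial `z z̄ z z̄ ⋯` with `n + 1` factors. -/
def altPow : ℕ → ℂ → ℂ
  | 0, z => z
  | n + 1, z => altPow n z * if Even n then conj z else z

theorem altPow_two_mul (k : ℕ) (z : ℂ) : altPow (2 * k) z = ((‖z‖ ^ (2 * k) : ℝ) : ℂ) * z := by
  induction k with
  | zero => simp [altPow]
  | succ k ih =>
    have h1 : ¬ Even (2 * k + 1) := by simp
    rw [show 2 * (k + 1) = 2 * k + 1 + 1 by ring, altPow, altPow, if_neg h1,
      if_pos (even_two_mul k), ih, mul_assoc (_ * z), mul_comm (conj z), Complex.mul_conj,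
      Complex.normSq_eq_norm_sq]
    push_cast
    ring

theorem ae_eq_of_synth {σ : ℝ} (hσ : 0 < σ) {r : ℝ} {g h : L2 d}
    (H : synth hσ r g =ᵐ[volume] synth hσ r h) : g = h :=
  synth_injective hσ r (Lp.ext H)

theorem synth_sub_ae {σ : ℝ} (hσ : 0 < σ) (r : ℝ) (g h : L2 d) :
    synth hσ r (g - h) =ᵐ[volume] fun x => synth hσ r g x - synth hσ r h x := by
  rw [map_sub]; exact Lp.coeFn_sub _ _

theorem synth_add_ae {σ : ℝ} (hσ : 0 < σ) (r : ℝ) (g h : L2 d) :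
    synth hσ r (g + h) =ᵐ[volume] fun x => synth hσ r g x + synth hσ r h x := by
  rw [map_add]; exact Lp.coeFn_add _ _

/-- Either the identity or complex conjugation, as an isometry of the Gevrey space. -/
theorem exists_synth_ite_conj {σ : ℝ} (hσ : 0 < σ) (r : ℝ) (P : Prop) [Decidable P] :
    ∃ J : L2 d → L2 d, (∀ g, synth hσ r (J g) =ᵐ[volume]
        fun x => if P then conj (synth hσ r g x) else synth hσ r g x) ∧
      (∀ g, ‖J g‖ = ‖g‖) ∧ ∀ g h, ‖J g - J h‖ = ‖g - h‖ := by
  by_cases hP : P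
  · simp only [if_pos hP]
    choose J hJ hJn using exists_synth_conj (d := d) hσ r
    refine ⟨J, hJ, hJn, fun g h => ?_⟩
    rw [← hJn (g - h)]
    congr 1
    refine ae_eq_of_synth hσ (r := r) ?_
    filter_upwards [synth_sub_ae hσ r (J g) (J h), synth_sub_ae hσ r g h, hJ g, hJ h, hJ (g - h)]
      with x h1 h2 h3 h4 h5
    rw [h1, h3, h4, h5, h2, map_sub]
  · simp only [if_neg hP]
    exact ⟨id, fun g => EventuallyEq.rfl, fun g => rfl, fun g h => rfl⟩

/-- Iterating the product law, each factor costs `e` derivatives as long as the sum of the two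
exponents involved stays nonnegative. -/
theorem exists_altPow_map {σ : ℝ} (hσ : 0 < σ) {s e : ℝ} (he : 0 ≤ e) (hse : (d : ℝ) / 2 < s + e)
    (n : ℕ) (hn : ((n : ℝ) - 1) * e ≤ 2 * s) :
    ∃ N : L2 d → L2 d, (∀ R : ℝ, ∃ K : ℝ≥0, LipschitzOnWith K N (Metric.closedBall 0 R)) ∧
      ∀ U, synth hσ (s - n * e) (N U) =ᵐ[volume] fun x => altPow n (synth hσ s U x) := by
  induction n with
  | zero =>
    refine ⟨id, fun R => ⟨1, LipschitzWith.id.lipschitzOnWith⟩, fun U => ?_⟩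
    simp only [Nat.cast_zero, zero_mul, sub_zero, id, altPow]
    exact EventuallyEq.rfl
  | succ n ih =>
    push_cast at hn
    have hne : 0 ≤ (n : ℝ) * e := by positivity
    obtain ⟨N, hN, hNs⟩ := ih (by linarith)
    obtain ⟨J, hJ, hJn, hJl⟩ := exists_synth_ite_conj (d := d) hσ s (Even n)
    obtain ⟨C, hC⟩ := exists_synth_mul (d := d) hσ (a := s - n * e) (b := s)
      (c := s - ((n + 1 : ℕ) : ℝ) * e) (by push_cast; linarith) (by push_cast; linarith)
      (by linarith) (by push_cast; linarith)
    choose B hB hBn using hC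
    refine ⟨fun U => B (N U) (J U), fun R => ?_, fun U => ?_⟩
    · obtain ⟨K, hK⟩ := hN R
      refine ⟨C * (K * R.toNNReal + (‖N 0‖₊ + K * R.toNNReal)),
        LipschitzOnWith.of_dist_le_mul fun U hU U' hU' => ?_⟩
      rw [mem_closedBall_zero_iff] at hU hU'
      have hR : 0 ≤ R := (norm_nonneg U).trans hU
      have hsplit : B (N U) (J U) - B (N U') (J U') =
          B (N U - N U') (J U) + B (N U') (J U - J U') := by
        refine ae_eq_of_synth hσ (r := s - ((n + 1 : ℕ) : ℝ) * e) ?_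
        filter_upwards [synth_sub_ae hσ (s - ((n + 1 : ℕ) : ℝ) * e) (B (N U) (J U))
          (B (N U') (J U')), synth_add_ae hσ (s - ((n + 1 : ℕ) : ℝ) * e) (B (N U - N U') (J U))
          (B (N U') (J U - J U')), hB (N U) (J U), hB (N U') (J U'), hB (N U - N U') (J U),
          hB (N U') (J U - J U'), synth_sub_ae hσ (s - n * e) (N U) (N U'),
          synth_sub_ae hσ s (J U) (J U')] with x h1 h2 h3 h4 h5 h6 h7 h8
        rw [h1, h2, h3, h4, h5, h6, h7, h8]
        ring
      have hd1 : ‖N U - N U'‖ ≤ K * ‖U - U'‖ := by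
        simpa [dist_eq_norm] using hK.dist_le_mul U (by simpa using hU) U' (by simpa using hU')
      have hd2 : ‖N U'‖ ≤ ‖N 0‖ + K * R := by
        have h1 := hK.dist_le_mul U' (by simpa using hU') 0 (by simpa using hR)
        rw [dist_eq_norm, dist_zero_right] at h1
        have h2 : ‖N U'‖ ≤ ‖N 0‖ + ‖N U' - N 0‖ := norm_le_norm_add_norm_sub' _ _
        have h3 : (K : ℝ) * ‖U'‖ ≤ K * R := by gcongr
        linarith
      rw [dist_eq_norm, dist_eq_norm, hsplit]
      push_cast
      rw [Real.coe_toNNReal R hR]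
      calc _ ≤ C * (‖N U - N U'‖ * ‖J U‖) + C * (‖N U'‖ * ‖J U - J U'‖) :=
            (norm_add_le _ _).trans (add_le_add (hBn _ _) (hBn _ _))
        _ ≤ C * ((K * ‖U - U'‖) * R) + C * ((‖N 0‖ + K * R) * ‖U - U'‖) := by
            rw [hJn, hJl]
            gcongr
        _ = _ := by ring
    · filter_upwards [hB (N U) (J U), hNs U, hJ U] with x h1 h2 h3
      rw [h1, h2, h3, altPow]

/-- Lowering the exponent of a Gevrey space. -/
theorem exists_synth_of_le {σ : ℝ} (hσ : 0 < σ) {r r' : ℝ} (h : r' ≤ r) :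
    ∃ B : L2 d →L[ℂ] L2 d, ∀ g, synth hσ r' (B g) = synth hσ r g := by
  refine ⟨mulOp (realMul (fun ζ => bracket ζ ^ (r' - r)) (continuous_bracket_rpow _) 1
    fun ζ => ?_), fun g => ?_⟩
  · rw [abs_of_nonneg (Real.rpow_nonneg (bracket_pos ζ).le _)]
    exact Real.rpow_le_one_of_one_le_of_nonpos (one_le_bracket ζ) (by linarith)
  · rw [synth_apply, synth_apply, mulOp_mulOp]
    congr 3
    ext ζ
    rw [BoundedContinuousFunction.mul_apply, invWeight_apply, invWeight_apply, realMul_apply,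
      show r = r' + (r - r') by ring, weight_add, ← Complex.ofReal_mul, mul_inv,
      ← Real.rpow_neg (bracket_pos ζ).le]
    ring_nf

/-- The nonlinearity `|u|^{p-1} u` maps `G^{σ,s}` to `G^{σ,s-1}`, Lipschitz on bounded sets, for odd
`p` and `s > d/2 - 1/p`: each of the `p - 1` products costs `1/p` derivatives. -/
theorem exists_nonlinearity {σ : ℝ} (hσ : 0 < σ) (hd : 1 ≤ d) {p : ℕ} (hp : 1 < p) (hpodd : Odd p)
    {s : ℝ} (hs : (d : ℝ) / 2 - 1 / (p : ℝ) < s) :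
    ∃ N : L2 d → L2 d, (∀ R : ℝ, ∃ K : ℝ≥0, LipschitzOnWith K N (Metric.closedBall 0 R)) ∧
      ∀ U, synth hσ (s - 1) (N U) =ᵐ[volume]
        fun x => ((‖synth hσ s U x‖ ^ (p - 1) : ℝ) : ℂ) * synth hσ s U x := by
  obtain ⟨k, rfl⟩ := hpodd
  have hp0 : (0 : ℝ) < ((2 * k + 1 : ℕ) : ℝ) := by positivity
  have hd1 : (1 : ℝ) ≤ d := by exact_mod_cast hd
  have hmul : ((2 * k + 1 : ℕ) : ℝ) * (1 / ((2 * k + 1 : ℕ) : ℝ)) = 1 := mul_one_div_cancel hp0.ne'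
  have he : 0 ≤ 1 / ((2 * k + 1 : ℕ) : ℝ) := by positivity
  generalize 1 / ((2 * k + 1 : ℕ) : ℝ) = e at *
  push_cast at hmul
  -- for `d = 1` nonnegativity of the exponent sums is exactly the hypothesis on `s`
  obtain ⟨N, hN, hNs⟩ := exists_altPow_map (d := d) hσ (s := s) (e := e) he (by linarith) (2 * k)
    (by push_cast; nlinarith)
  obtain ⟨B, hB⟩ := exists_synth_of_le (d := d) hσ (r := s - ((2 * k : ℕ) : ℝ) * e) (r' := s - 1)
    (by push_cast; nlinarith)
  refine ⟨fun U => B (N U), fun R => ?_, fun U => ?_⟩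
  · obtain ⟨K, hK⟩ := hN R
    exact ⟨‖B‖₊ * K, B.lipschitz.comp_lipschitzOnWith hK⟩
  · rw [hB]
    filter_upwards [hNs U] with x hx
    rw [hx, altPow_two_mul, Nat.add_sub_cancel]

/-! ### The Cauchy problem as a first-order system -/

theorem continuousInGevrey_iff {σ : ℝ} (hσ : 0 < σ) {r δ : ℝ} {u U : ℝ → L2 d}
    (hu : ∀ t ∈ Ico 0 δ, u t = synth hσ r (U t)) :
    ContinuousInGevrey σ r δ u ↔ ContinuousOn U (Ico 0 δ) := by
  refine forall₂_congr fun t ht => ?_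
  have h1 : (fun τ => gevreyNorm σ r (u τ - u t)) =ᶠ[𝓝[Ico 0 δ] t]
      fun τ => gevreyNorm σ r (synth hσ r (U τ - U t)) := by
    filter_upwards [self_mem_nhdsWithin] with τ hτ
    rw [map_sub, hu τ hτ, hu t ht]
  rw [tendsto_congr' h1, tendsto_gevreyNorm_synth, ContinuousWithinAt, hu t ht,
    tendsto_sub_nhds_zero_iff]
  exact and_iff_right (memGevrey_synth hσ r _)

theorem hasTimeDerivInGevrey_iff {σ : ℝ} (hσ : 0 < σ) {s δ : ℝ} {u v U V : ℝ → L2 d}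
    (hu : ∀ t ∈ Ico 0 δ, u t = synth hσ s (U t))
    (hv : ∀ t ∈ Ico 0 δ, v t = synth hσ (s - 1) (V t)) :
    HasTimeDerivInGevrey σ (s - 1) δ u v ↔
      ∀ t ∈ Ico 0 δ, HasDerivWithinAt (fun τ => mulOp invBracket (U τ)) (V t) (Ico 0 δ) t := by
  refine forall₂_congr fun t ht => ?_
  have hu' : ∀ t ∈ Ico 0 δ, u t = synth hσ (s - 1) (mulOp invBracket (U t)) := fun t ht => by
    rw [synth_mulOp_invBracket, sub_add_cancel, hu t ht]
  have h1 : (fun τ => gevreyNorm σ (s - 1) ((τ - t)⁻¹ • (u τ - u t) - v t))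
      =ᶠ[𝓝[Ico 0 δ \ {t}] t]
      fun τ => gevreyNorm σ (s - 1)
        (synth hσ (s - 1) (slope (fun τ => mulOp invBracket (U τ)) t τ - V t)) := by
    filter_upwards [self_mem_nhdsWithin] with τ hτ
    rw [slope_def_module, map_sub, ContinuousLinearMap.map_smul_of_tower, map_sub, hu' τ hτ.1, hu' t ht, hv t ht]
  rw [tendsto_congr' h1, tendsto_gevreyNorm_synth, hasDerivWithinAt_iff_tendsto_slope,
    tendsto_sub_nhds_zero_iff]

/-- The pairing of `synth hσ r g` with a test function, as a functional of `g`. -/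
def testFunctional {σ : ℝ} (hσ : 0 < σ) (r : ℝ) (ψ : 𝓢(Space d, ℂ)) : L2 d →L[ℝ] ℂ :=
  ((((ContinuousLinearMap.mul ℂ ℂ).lpPairing volume 2 2).flip (ψ.toLp 2)).comp
    (synth hσ r)).restrictScalars ℝ

theorem testFunctional_apply {σ : ℝ} (hσ : 0 < σ) (r : ℝ) (ψ : 𝓢(Space d, ℂ)) (g : L2 d) :
    testFunctional hσ r ψ g = ∫ x, synth hσ r g x * ψ x := by
  simp only [testFunctional, ContinuousLinearMap.coe_restrictScalars',
    ContinuousLinearMap.comp_apply, ContinuousLinearMap.flip_apply,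
    ContinuousLinearMap.lpPairing_eq_integral, ContinuousLinearMap.mul_apply']
  refine integral_congr_ae ?_
  filter_upwards [ψ.coeFn_toLp 2 volume] with x hx
  rw [hx]

theorem eq_zero_of_testFunctional {σ : ℝ} (hσ : 0 < σ) (r : ℝ) (g : L2 d)
    (h : ∀ ψ, testFunctional hσ r ψ g = 0) : g = 0 := by
  refine synth_injective hσ r ?_
  rw [map_zero]
  refine Lp.ext ?_
  have h0 : ∀ᵐ x, synth hσ r g x = 0 := by
    refine ae_eq_zero_of_integral_contDiff_smul_eq_zero
      ((Lp.memLp _).locallyIntegrable (by norm_num)) fun φ hφ hφs => ?_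
    have hs : HasCompactSupport fun x => (φ x : ℂ) := hφs.comp_left Complex.ofReal_zero
    have hd : ContDiff ℝ ∞ fun x => (φ x : ℂ) := Complex.ofRealCLM.contDiff.comp hφ
    have h1 := h (hs.toSchwartzMap hd)
    rw [testFunctional_apply] at h1
    simpa [mul_comm] using h1
  filter_upwards [h0, Lp.coeFn_zero ℂ 2 (volume : Measure (Space d))] with x h1 h2
  rw [h1, h2, Pi.zero_apply]

theorem fourierInv_laplacian_apply (ψ : 𝓢(Space d, ℂ)) (ζ : Space d) :
    (𝓕⁻ (Δ ψ) : 𝓢(Space d, ℂ)) ζ =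
      ((-(2 * π * ‖ζ‖) ^ 2 : ℝ) : ℂ) * (𝓕⁻ ψ : 𝓢(Space d, ℂ)) ζ := by
  have hg : (fun x : Space d => ‖x‖ ^ 2).HasTemperateGrowth := by fun_prop
  have h : (𝓕 (Δ ψ) : 𝓢(Space d, ℂ)) (-ζ) =
      ((-(2 * π * ‖ζ‖) ^ 2 : ℝ) : ℂ) * (𝓕 ψ : 𝓢(Space d, ℂ)) (-ζ) := by
    rw [SchwartzMap.laplacian_eq_fourierMultiplierCLM, SchwartzMap.fourierMultiplierCLM_apply,
      FourierTransform.fourier_smul, FourierTransform.fourier_fourierInv_eq, _root_.smul_apply,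
      SchwartzMap.smulLeftCLM_apply_apply (by simpa [Pi.pow_def] using hg)]
    simp
    ring
  simpa [SchwartzMap.fourierInv_coe, SchwartzMap.fourier_coe, Real.fourierInv_eq_fourier_neg] using h

/-- Since `-|ξ|² = 1 - ⟨ξ⟩²`, the Laplacian acts from order `s` to order `s - 2` as
`g ↦ -g + ⟨ξ⟩⁻² g`. -/
theorem integral_synth_mul_laplacian {σ : ℝ} (hσ : 0 < σ) (s : ℝ) (g : L2 d)
    (ψ : 𝓢(Space d, ℂ)) :
    ∫ x, synth hσ s g x * (Δ ψ) x =
      testFunctional hσ (s - 1 - 1) ψ (-g + mulOp invBracket (mulOp invBracket g)) := by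
  rw [testFunctional_apply, integral_synth_mul_schwartz, integral_synth_mul_schwartz]
  refine integral_congr_ae ?_
  rw [mulOp_mulOp]
  filter_upwards [Lp.coeFn_add (-g) (mulOp (invBracket * invBracket) g), Lp.coeFn_neg g,
    coeFn_mulOp (invBracket * invBracket) g] with ζ h1 h2 h3
  rw [h1, Pi.add_apply, h2, Pi.neg_apply, h3, fourierInv_laplacian_apply, invWeight_apply,
    invWeight_apply, BoundedContinuousFunction.mul_apply, invBracket_apply,
    show s = s - 1 - 1 + ((2 : ℕ) : ℝ) by push_cast; ring, weight_add, Real.rpow_natCast,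
    show s - 1 - 1 + ((2 : ℕ) : ℝ) - 1 - 1 = s - 1 - 1 by push_cast; ring]
  have h4 := bracket_sq ζ
  have h5 : (bracket ζ : ℂ) ≠ 0 := by exact_mod_cast (bracket_pos ζ).ne'
  have h6 : (weight σ (s - 1 - 1) ζ : ℂ) ≠ 0 := by exact_mod_cast (weight_pos _ _ ζ).ne'
  have h7 : -(2 * π * ‖ζ‖) ^ 2 = 1 - bracket ζ ^ 2 := by rw [h4]; ring
  rw [h7]
  push_cast
  field_simp
  ring

/-- The bounded part of the first-order system: the wave equation is written as
`u_tt + ⟨D⟩² u = u - |u|^{p-1} u`, with `N` standing for the nonlinearity. -/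
def perturbation (N : L2 d → L2 d) (z : L2 d × L2 d) : L2 d × L2 d :=
  (0, mulOp invBracket z.1 - N z.1)

theorem perturbation_lipschitzOnWith {N : L2 d → L2 d}
    (hN : ∀ R : ℝ, ∃ K : ℝ≥0, LipschitzOnWith K N (Metric.closedBall 0 R)) (R : ℝ) :
    ∃ K : ℝ≥0, LipschitzOnWith K (perturbation N) (Metric.closedBall 0 R) := by
  obtain ⟨K, hK⟩ := hN R
  refine ⟨‖(mulOp invBracket : L2 d →L[ℂ] L2 d)‖₊ + K,
    LipschitzOnWith.of_dist_le_mul fun x hx y hy => ?_⟩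
  rw [mem_closedBall_zero_iff] at hx hy
  have h1 := hK.dist_le_mul x.1 (by simpa using (norm_fst_le x).trans hx) y.1
    (by simpa using (norm_fst_le y).trans hy)
  have h3 : ‖x.1 - y.1‖ ≤ ‖x - y‖ := norm_fst_le (x - y)
  rw [dist_eq_norm, dist_eq_norm] at h1 ⊢
  have h2 : perturbation N x - perturbation N y =
      (0, mulOp invBracket (x.1 - y.1) - (N x.1 - N y.1)) := by
    simp only [perturbation, Prod.mk_sub_mk, sub_zero, map_sub]
    congr 1
    abel
  rw [h2, Prod.norm_def, norm_zero, max_eq_right (norm_nonneg _)]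
  push_cast
  calc _ ≤ ‖(mulOp invBracket : L2 d →L[ℂ] L2 d)‖ * ‖x.1 - y.1‖ + K * ‖x.1 - y.1‖ :=
        (norm_sub_le _ _).trans (add_le_add (ContinuousLinearMap.le_opNorm _ _) h1)
    _ ≤ ‖(mulOp invBracket : L2 d →L[ℂ] L2 d)‖ * ‖x - y‖ + K * ‖x - y‖ := by gcongr
    _ = _ := by ring

section Equivalence

variable {σ s δ : ℝ} {p : ℕ} {N : L2 d → L2 d}

/-- The equation in the sense of distributions is equivalent to a strong equation in `L²`, after
multiplication by `⟨ξ⟩⁻¹`. -/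
theorem solvesNLW_iff (hσ : 0 < σ) (hNc : Continuous N)
    (hN : ∀ U, synth hσ (s - 1) (N U) =ᵐ[volume]
        fun x => ((‖synth hσ s U x‖ ^ (p - 1) : ℝ) : ℂ) * synth hσ s U x)
    {u v U V : ℝ → L2 d}
    (hu : ∀ t ∈ Ico 0 δ, u t = synth hσ s (U t))
    (hv : ∀ t ∈ Ico 0 δ, v t = synth hσ (s - 1) (V t)) (hU : ContinuousOn U (Ico 0 δ)) :
    SolvesNLW p δ u v ↔ ∀ t ∈ Ico 0 δ, HasDerivWithinAt (fun τ => mulOp invBracket (V τ))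
      (-U t + mulOp invBracket (mulOp invBracket (U t) - N (U t))) (Ico 0 δ) t := by
  have hpair : ∀ t ∈ Ico 0 δ, ∀ ψ : 𝓢(Space d, ℂ), ∫ x, v t x * ψ x =
      testFunctional hσ (s - 1 - 1) ψ (mulOp invBracket (V t)) := fun t ht ψ => by
    rw [testFunctional_apply, synth_mulOp_invBracket, sub_add_cancel, hv t ht]
  have hnl : ∀ t ∈ Ico 0 δ, ∀ ψ : 𝓢(Space d, ℂ),
      (fun x => synth hσ (s - 1) (N (U t)) x * ψ x) =ᵐ[volume]
        fun x => ((‖u t x‖ ^ (p - 1) : ℝ) : ℂ) * u t x * ψ x := fun t ht ψ => by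
    filter_upwards [hN (U t)] with x hx
    rw [hx, hu t ht]
  have hrhs : ∀ t ∈ Ico 0 δ, ∀ ψ : 𝓢(Space d, ℂ), (∫ x, u t x * (Δ ψ) x) -
      ∫ x, ((‖u t x‖ ^ (p - 1) : ℝ) : ℂ) * u t x * ψ x =
      testFunctional hσ (s - 1 - 1) ψ
        (-U t + mulOp invBracket (mulOp invBracket (U t) - N (U t))) := fun t ht ψ => by
    rw [← integral_congr_ae (hnl t ht ψ), hu t ht, integral_synth_mul_laplacian, map_sub,
      ← add_sub_assoc, map_sub (testFunctional hσ (s - 1 - 1) ψ), testFunctional_apply hσ _ ψ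
      (mulOp invBracket (N (U t))), synth_mulOp_invBracket, sub_add_cancel]
  constructor
  · intro h
    refine hasDerivWithinAt_of_separating (testFunctional hσ (s - 1 - 1))
      (eq_zero_of_testFunctional hσ (s - 1 - 1)) ?_ fun ψ t ht => ?_
    · exact hU.neg.add ((mulOp invBracket).continuous.comp_continuousOn
        (((mulOp invBracket).continuous.comp_continuousOn hU).sub (hNc.comp_continuousOn hU)))
    · have h1 := (h t ht ψ).2
      rw [hrhs t ht ψ] at h1
      exact h1.congr (fun τ hτ => (hpair τ hτ ψ).symm) (hpair t ht ψ).symm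
  · intro h t ht ψ
    refine ⟨Integrable.congr ?_ (hnl t ht ψ), ?_⟩
    · exact (Lp.memLp (synth hσ (s - 1) (N (U t)))).integrable_mul (ψ.memLp 2 volume)
    · rw [hrhs t ht ψ]
      exact ((testFunctional hσ (s - 1 - 1) ψ).hasFDerivAt.comp_hasDerivWithinAt t (h t ht)).congr
        (fun τ hτ => hpair τ hτ ψ) (hpair t ht ψ)

/-- Solutions of the Cauchy problem correspond to solutions of the first-order system. -/
theorem isStrongSol_of_isSolution (hσ : 0 < σ) (hNc : Continuous N)
    (hN : ∀ U, synth hσ (s - 1) (N U) =ᵐ[volume]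
        fun x => ((‖synth hσ s U x‖ ^ (p - 1) : ℝ) : ℂ) * synth hσ s U x)
    {a b : L2 d} {u v : ℝ → L2 d} (h : IsSolution p σ s δ a b u v) :
    ∃ z : ℝ → L2 d × L2 d, IsStrongSol regularizer quarterTurn (perturbation N) δ z ∧
      ∀ t ∈ Ico 0 δ, u t = synth hσ s (z t).1 ∧ v t = synth hσ (s - 1) (z t).2 := by
  have hex : ∀ t, ∃ y : L2 d × L2 d, t ∈ Ico 0 δ →
      u t = synth hσ s y.1 ∧ v t = synth hσ (s - 1) y.2 := fun t => by
    by_cases ht : t ∈ Ico 0 δ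
    · obtain ⟨g, hg⟩ := exists_synth_of_memGevrey hσ (h.continuous t ht).1
      obtain ⟨g', hg'⟩ := exists_synth_of_memGevrey hσ (h.continuous_deriv t ht).1
      exact ⟨(g, g'), fun _ => ⟨hg.symm, hg'.symm⟩⟩
    · exact ⟨0, fun h => absurd h ht⟩
  choose z hz using hex
  have hu := fun t ht => (hz t ht).1
  have hv := fun t ht => (hz t ht).2
  have hU := (continuousInGevrey_iff hσ hu).1 h.continuous
  have hV := (continuousInGevrey_iff hσ hv).1 h.continuous_deriv
  have h1 := (hasTimeDerivInGevrey_iff hσ hu hv).1 h.hasTimeDeriv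
  have h2 := (solvesNLW_iff hσ hNc hN hu hv hU).1 h.equation
  refine ⟨z, ⟨hU.prodMk hV, fun t ht => ?_⟩, hz⟩
  have h3 := (h1 t ht).prodMk (h2 t ht)
  simpa [regularizer_apply, quarterTurn_apply, perturbation] using h3

theorem IsStrongSol.isSolution (hσ : 0 < σ) (hNc : Continuous N)
    (hN : ∀ U, synth hσ (s - 1) (N U) =ᵐ[volume]
        fun x => ((‖synth hσ s U x‖ ^ (p - 1) : ℝ) : ℂ) * synth hσ s U x)
    {z : ℝ → L2 d × L2 d} (h : IsStrongSol regularizer quarterTurn (perturbation N) δ z) :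
    IsSolution p σ s δ (synth hσ s (z 0).1) (synth hσ (s - 1) (z 0).2)
      (fun t => synth hσ s (z t).1) (fun t => synth hσ (s - 1) (z t).2) := by
  have hU : ContinuousOn (fun t => (z t).1) (Ico 0 δ) := continuous_fst.comp_continuousOn h.cont
  have hV : ContinuousOn (fun t => (z t).2) (Ico 0 δ) := continuous_snd.comp_continuousOn h.cont
  refine ⟨(continuousInGevrey_iff hσ fun _ _ => rfl).2 hU,
    (hasTimeDerivInGevrey_iff hσ (fun _ _ => rfl) fun _ _ => rfl).2 fun t ht => ?_,
    (continuousInGevrey_iff hσ fun _ _ => rfl).2 hV,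
    (solvesNLW_iff hσ hNc hN (fun _ _ => rfl) (fun _ _ => rfl) hU).2 fun t ht => ?_, rfl, rfl⟩
  · have h1 := (ContinuousLinearMap.fst ℝ (L2 d) (L2 d)).hasFDerivAt.comp_hasDerivWithinAt t
      (h.deriv t ht)
    simpa [regularizer_apply, quarterTurn_apply, perturbation, Function.comp_def] using h1
  · have h1 := (ContinuousLinearMap.snd ℝ (L2 d) (L2 d)).hasFDerivAt.comp_hasDerivWithinAt t
      (h.deriv t ht)
    simpa [regularizer_apply, quarterTurn_apply, perturbation, Function.comp_def] using h1

end Equivalence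

/-! ### Analyticity in the tube -/

/-- The linear form `z ↦ ∑ j, ζ j * z j` on `ℂ^d` attached to a real frequency `ζ`. -/
def complexPairing (ζ : Space d) : EuclideanSpace ℂ (Fin d) →L[ℂ] ℂ :=
  innerSL ℂ (WithLp.toLp 2 fun j => ((ζ j : ℝ) : ℂ))

theorem complexPairing_apply (ζ : Space d) (z : EuclideanSpace ℂ (Fin d)) :
    complexPairing ζ z = ∑ j, (ζ j : ℂ) * z j := by
  simp [complexPairing, PiLp.inner_apply, mul_comm]

theorem continuous_complexPairing :
    Continuous (complexPairing : Space d → EuclideanSpace ℂ (Fin d) →L[ℂ] ℂ) := by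
  unfold complexPairing
  refine (innerSL ℂ).continuous.comp ?_
  fun_prop

theorem norm_complexPairing (ζ : Space d) : ‖complexPairing ζ‖ = ‖ζ‖ := by
  rw [complexPairing, innerSL_apply_norm, EuclideanSpace.norm_eq, EuclideanSpace.norm_eq]
  simp

/-- The exponential `e^{2 π i z · ζ}`. -/
def complexWave (z : EuclideanSpace ℂ (Fin d)) (ζ : Space d) : ℂ :=
  Complex.exp (2 * π * Complex.I * complexPairing ζ z)

theorem continuous_complexWave (z : EuclideanSpace ℂ (Fin d)) : Continuous (complexWave z) := by
  unfold complexWave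
  have := (continuous_complexPairing (d := d)).clm_apply (continuous_const (y := z))
  fun_prop

theorem norm_complexWave_le (z : EuclideanSpace ℂ (Fin d)) (ζ : Space d) :
    ‖complexWave z ζ‖ ≤ Real.exp (2 * π * Real.sqrt (∑ j, (z j).im ^ 2) * ‖ζ‖) := by
  have him : (complexPairing ζ z).im = inner ℝ (WithLp.toLp 2 fun j => (z j).im : Space d) ζ := by
    rw [complexPairing_apply, Complex.im_sum]
    simp [PiLp.inner_apply]
  have hcs := abs_real_inner_le_norm (WithLp.toLp 2 fun j => (z j).im : Space d) ζ
  have hn : ‖(WithLp.toLp 2 fun j => (z j).im : Space d)‖ = Real.sqrt (∑ j, (z j).im ^ 2) := by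
    rw [EuclideanSpace.norm_eq]
    simp
  rw [hn, ← him] at hcs
  have hre : (2 * π * Complex.I * complexPairing ζ z).re = -(2 * π * (complexPairing ζ z).im) := by
    simp [Complex.mul_re, Complex.mul_im]
  rw [complexWave, Complex.norm_exp, Real.exp_le_exp, hre, mul_assoc (2 * π), ← mul_neg]
  gcongr
  exact (neg_le_abs _).trans hcs

/-- The growth of the derivative of `complexWave` for `|y| < ρ` is absorbed by the weight, at the cost
of lowering `σ` to `σ - ρ` and `r` to `r - 1`. -/
theorem norm_mul_inv_weight_le (σ ρ r : ℝ) (ζ : Space d) :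
    2 * π * ‖ζ‖ * (Real.exp (2 * π * ρ * ‖ζ‖) * (weight σ r ζ)⁻¹) ≤
      (weight (σ - ρ) (r - 1) ζ)⁻¹ := by
  have h1 : weight σ r ζ =
      Real.exp (2 * π * ρ * ‖ζ‖) * (weight (σ - ρ) (r - 1) ζ * bracket ζ) := by
    rw [← Real.rpow_one (bracket ζ), ← weight_add, sub_add_cancel, ← weight_exp_add,
      sub_add_cancel]
  have h2 : 2 * π * ‖ζ‖ ≤ bracket ζ := Real.le_sqrt_of_sq_le (by linarith)
  have h3 := bracket_pos ζ
  have h4 := weight_pos (σ - ρ) (r - 1) ζ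
  have h5 := Real.exp_pos (2 * π * ρ * ‖ζ‖)
  rw [h1, mul_inv, mul_inv_cancel_left₀ h5.ne', mul_inv]
  calc _ = (weight (σ - ρ) (r - 1) ζ)⁻¹ * (2 * π * ‖ζ‖ * (bracket ζ)⁻¹) := by ring
    _ ≤ (weight (σ - ρ) (r - 1) ζ)⁻¹ * 1 := by
      gcongr
      rwa [← div_eq_mul_inv, div_le_one h3]
    _ = _ := mul_one _

/-- Paley–Wiener: the Fourier integral of an element of `G^{σ,r}` converges in the tube. -/
theorem analyticInTube_synth {σ : ℝ} (hσ : 0 < σ) (r : ℝ) (g : L2 d) :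
    AnalyticInTube σ (synth hσ r g) := by
  have hint := integrable_invWeight_mul hσ r g
  refine ⟨fun z => ∫ ζ, complexWave z ζ * (invWeight hσ r ζ * g ζ), ?_, ?_⟩
  · intro z hz
    obtain ⟨ρ, hρ1, hρ2⟩ := exists_between (mem_ofPred.1 hz)
    have hopen : IsOpen {z : EuclideanSpace ℂ (Fin d) | Real.sqrt (∑ j, (z j).im ^ 2) < ρ} :=
      isOpen_lt (by fun_prop) continuous_const
    have hnorm : ∀ w : EuclideanSpace ℂ (Fin d), Real.sqrt (∑ j, (w j).im ^ 2) < ρ → ∀ ζ,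
        ‖complexWave w ζ‖ ≤ Real.exp (2 * π * ρ * ‖ζ‖) := fun w hw ζ =>
      (norm_complexWave_le w ζ).trans (Real.exp_le_exp.2 (by gcongr))
    have hmeas : ∀ w : EuclideanSpace ℂ (Fin d), AEStronglyMeasurable
        (fun ζ => complexWave w ζ * (invWeight hσ r ζ * g ζ)) volume := fun w =>
      (continuous_complexWave w).aestronglyMeasurable.mul hint.aestronglyMeasurable
    have hσρ : 0 < σ - ρ := sub_pos.2 hρ2
    have hval : ∀ (τ q : ℝ) (hτ : 0 < τ) (ζ : Space d),
        ‖invWeight hτ q ζ * g ζ‖ = (weight τ q ζ)⁻¹ * ‖g ζ‖ := fun τ q hτ ζ => by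
      rw [norm_mul, invWeight_apply, Complex.norm_real,
        Real.norm_of_nonneg (inv_nonneg.2 (weight_pos _ _ _).le)]
    have hF0 : Integrable (fun ζ => complexWave z ζ * (invWeight hσ r ζ * g ζ)) := by
      refine (integrable_invWeight_mul hσρ r g).norm.mono' (hmeas z)
        (Eventually.of_forall fun ζ => ?_)
      rw [norm_mul, hval, hval]
      have h1 : weight σ r ζ = Real.exp (2 * π * ρ * ‖ζ‖) * weight (σ - ρ) r ζ := by
        rw [← weight_exp_add, sub_add_cancel]
      have h2 := Real.exp_pos (2 * π * ρ * ‖ζ‖)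
      calc _ ≤ Real.exp (2 * π * ρ * ‖ζ‖) * ((weight σ r ζ)⁻¹ * ‖g ζ‖) := by
            gcongr
            · exact mul_nonneg (inv_nonneg.2 (weight_pos _ _ _).le) (norm_nonneg _)
            · exact hnorm z hρ1 ζ
        _ = _ := by rw [h1, mul_inv, ← mul_assoc, mul_inv_cancel_left₀ h2.ne']
    have key := hasFDerivAt_integral_of_dominated_of_fderiv_le (𝕜 := ℂ) (μ := volume) (x₀ := z)
      (F := fun w ζ => complexWave w ζ * (invWeight hσ r ζ * g ζ))
      (F' := fun w ζ => (complexWave w ζ * (invWeight hσ r ζ * g ζ) * (2 * π * Complex.I)) •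
        complexPairing ζ)
      (bound := fun ζ => ‖invWeight hσρ (r - 1) ζ * g ζ‖)
      (hopen.mem_nhds hρ1) (Eventually.of_forall hmeas) hF0 ?_ ?_
      (integrable_invWeight_mul hσρ (r - 1) g).norm ?_
    · exact key.differentiableAt.differentiableWithinAt
    · exact ((hmeas z).mul_const _).smul continuous_complexPairing.aestronglyMeasurable
    · refine Eventually.of_forall fun ζ w hw => ?_
      rw [norm_smul, norm_complexPairing, norm_mul, norm_mul, hval, hval]
      have h1 : ‖(2 * π * Complex.I : ℂ)‖ = 2 * π := by
        simp [abs_of_pos Real.pi_pos]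
      have h2 := norm_mul_inv_weight_le σ ρ r ζ
      rw [h1]
      calc _ = 2 * π * ‖ζ‖ * (‖complexWave w ζ‖ * (weight σ r ζ)⁻¹) * ‖g ζ‖ := by ring
        _ ≤ 2 * π * ‖ζ‖ * (Real.exp (2 * π * ρ * ‖ζ‖) * (weight σ r ζ)⁻¹) * ‖g ζ‖ := by
          have := weight_pos σ r ζ
          gcongr
          exact hnorm w hw ζ
        _ ≤ _ := by gcongr
    · refine Eventually.of_forall fun ζ w _ => ?_
      have h1 : HasFDerivAt (fun w => 2 * π * Complex.I * complexPairing ζ w)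
          ((2 * π * Complex.I : ℂ) • complexPairing ζ) w :=
        (complexPairing ζ).hasFDerivAt.const_mul _
      refine (h1.cexp.mul_const (invWeight hσ r ζ * g ζ)).congr_fderiv ?_
      rw [smul_smul, smul_smul, complexWave]
      congr 1
      ring
  · filter_upwards [synth_ae_eq hσ r g] with x hx
    rw [hx, Real.fourierInv_eq']
    refine integral_congr_ae (Eventually.of_forall fun ζ => ?_)
    simp only [smul_eq_mul, complexWave, complexPairing_apply]
    congr 2
    rw [PiLp.inner_apply]
    push_cast
    simp only [RCLike.inner_apply, conj_trivial]
    push_cast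
    rw [Finset.sum_congr rfl fun j _ => mul_comm (x j : ℂ) (ζ j : ℂ)]
    ring

/-! ### Local well-posedness -/

theorem pairDist_synth {σ : ℝ} (hσ : 0 < σ) (s : ℝ) (y z : L2 d × L2 d) :
    pairDist σ s (synth hσ s y.1) (synth hσ (s - 1) y.2) (synth hσ s z.1) (synth hσ (s - 1) z.2) =
      fourierScale d * (‖(y - z).1‖ₑ + ‖(y - z).2‖ₑ) := by
  rw [pairDist, ← map_sub, ← map_sub, gevreyNorm_synth, gevreyNorm_synth, mul_add, Prod.fst_sub,
    Prod.snd_sub]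

theorem exists_synth_of_gevreyNorm_sub_lt {σ : ℝ} (hσ : 0 < σ) {r : ℝ} {g f : L2 d}
    (h : gevreyNorm σ r (f - synth hσ r g) < ⊤) : ∃ g', synth hσ r g' = f := by
  obtain ⟨k, hk⟩ := exists_synth_of_memGevrey hσ h
  exact ⟨k + g, by rw [map_add, hk, sub_add_cancel]⟩

theorem enorm_fst_add_enorm_snd_le (z : L2 d × L2 d) : ‖z.1‖ₑ + ‖z.2‖ₑ ≤ 2 * ‖z‖ₑ := by
  rw [two_mul]
  gcongr
  · exact enorm_le_iff_norm_le.2 (norm_fst_le z)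
  · exact enorm_le_iff_norm_le.2 (norm_snd_le z)

theorem enorm_le_enorm_fst_add_enorm_snd (z : L2 d × L2 d) : ‖z‖ₑ ≤ ‖z.1‖ₑ + ‖z.2‖ₑ := by
  rw [← ofReal_norm, ← ofReal_norm, ← ofReal_norm,
    ← ENNReal.ofReal_add (norm_nonneg _) (norm_nonneg _)]
  refine ENNReal.ofReal_le_ofReal (max_le ?_ ?_)
  · exact le_add_of_nonneg_right (norm_nonneg _)
  · exact le_add_of_nonneg_left (norm_nonneg _)

end

end GevreyNLW

theorem theorem1 (d : ℕ) (hd : 1 ≤ d) (p : ℕ) (hp : 1 < p) (hpodd : Odd p) (σ s : ℝ)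
    (hσ : 0 < σ) (hs : (d : ℝ) / 2 - 1 / (p : ℝ) < s)
    (u₀ u₁ : GevreyNLW.L2 d) (hu₀ : GevreyNLW.MemGevrey σ s u₀)
    (hu₁ : GevreyNLW.MemGevrey σ (s - 1) u₁) :
    ∃ δ : ℝ, 0 < δ ∧ ∃ r : ℝ≥0∞, 0 < r ∧
      -- `S a b` is the solution with data `(a, b)`, and `S' a b` is its time derivative
      ∃ S S' : GevreyNLW.L2 d → GevreyNLW.L2 d → ℝ → GevreyNLW.L2 d,
        -- existence, uniqueness and spatial analyticity for all data near `(u₀, u₁)`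
        (∀ a b : GevreyNLW.L2 d, GevreyNLW.pairDist σ s a b u₀ u₁ < r →
          GevreyNLW.IsSolution p σ s δ a b (S a b) (S' a b) ∧
          (∀ u v : ℝ → GevreyNLW.L2 d, GevreyNLW.IsSolution p σ s δ a b u v →
            ∀ t ∈ Ico 0 δ, u t = S a b t ∧ v t = S' a b t) ∧
          (∀ t ∈ Ico 0 δ, GevreyNLW.AnalyticInTube σ (S a b t))) ∧
        -- continuity of the solution map, uniformly in time
        (∀ a b : GevreyNLW.L2 d, GevreyNLW.pairDist σ s a b u₀ u₁ < r →
          ∀ ε : ℝ≥0∞, 0 < ε → ∃ η : ℝ≥0∞, 0 < η ∧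
            ∀ a' b' : GevreyNLW.L2 d, GevreyNLW.pairDist σ s a' b' u₀ u₁ < r →
              GevreyNLW.pairDist σ s a' b' a b < η →
              ∀ t ∈ Ico 0 δ,
                GevreyNLW.pairDist σ s (S a' b' t) (S' a' b' t) (S a b t) (S' a b t) < ε) := by
  obtain ⟨A₀, rfl⟩ := GevreyNLW.exists_synth_of_memGevrey hσ hu₀
  obtain ⟨B₀, rfl⟩ := GevreyNLW.exists_synth_of_memGevrey hσ hu₁
  obtain ⟨N, hNL, hN⟩ := GevreyNLW.exists_nonlinearity (d := d) hσ hd hp hpodd hs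
  have hNc := GevreyNLW.continuous_of_lipschitzOnWith_closedBall hNL
  obtain ⟨δ, hδ, ρ, hρ, Φ, L, hΦ, hL⟩ := GevreyNLW.exists_flow
    GevreyNLW.isGroupGeneratedBy_rotation (GevreyNLW.perturbation_lipschitzOnWith hNL) (A₀, B₀)
  have hκ0 := GevreyNLW.fourierScale_ne_zero (d := d)
  have hκt := GevreyNLW.fourierScale_ne_top (d := d)
  -- data near `(u₀, u₁)` come from initial values near `(A₀, B₀)`
  have hdata : ∀ a b : GevreyNLW.L2 d, GevreyNLW.pairDist σ s a b (GevreyNLW.synth hσ s A₀)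
      (GevreyNLW.synth hσ (s - 1) B₀) < GevreyNLW.fourierScale d * ENNReal.ofReal ρ →
      ∃ z ∈ Metric.closedBall (A₀, B₀) ρ,
        GevreyNLW.synth hσ s z.1 = a ∧ GevreyNLW.synth hσ (s - 1) z.2 = b := by
    intro a b hab
    have htop := hab.trans (ENNReal.mul_lt_top hκt.lt_top ENNReal.ofReal_lt_top)
    obtain ⟨A, rfl⟩ := GevreyNLW.exists_synth_of_gevreyNorm_sub_lt hσ
      (lt_of_le_of_lt le_self_add htop)
    obtain ⟨B, rfl⟩ := GevreyNLW.exists_synth_of_gevreyNorm_sub_lt hσ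
      (lt_of_le_of_lt le_add_self htop)
    refine ⟨(A, B), ?_, rfl, rfl⟩
    rw [GevreyNLW.pairDist_synth hσ s (A, B) (A₀, B₀), ENNReal.mul_lt_mul_iff_right hκ0 hκt] at hab
    have h1 := (GevreyNLW.enorm_le_enorm_fst_add_enorm_snd ((A, B) - (A₀, B₀))).trans hab.le
    rwa [← ofReal_norm, ENNReal.ofReal_le_ofReal_iff hρ.le, ← mem_closedBall_iff_norm] at h1
  set lift : GevreyNLW.L2 d → GevreyNLW.L2 d → GevreyNLW.L2 d × GevreyNLW.L2 d := fun a b =>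
    (Function.invFun (GevreyNLW.synth hσ s) a, Function.invFun (GevreyNLW.synth hσ (s - 1)) b)
    with hlift
  have hlift_synth : ∀ z : GevreyNLW.L2 d × GevreyNLW.L2 d,
      lift (GevreyNLW.synth hσ s z.1) (GevreyNLW.synth hσ (s - 1) z.2) = z := fun z =>
    Prod.ext (Function.leftInverse_invFun (GevreyNLW.synth_injective hσ s) z.1)
      (Function.leftInverse_invFun (GevreyNLW.synth_injective hσ (s - 1)) z.2)
  refine ⟨δ, hδ, GevreyNLW.fourierScale d * ENNReal.ofReal ρ,
    ENNReal.mul_pos hκ0 (ENNReal.ofReal_pos.2 hρ).ne',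
    fun a b t => GevreyNLW.synth hσ s (Φ (lift a b) t).1,
    fun a b t => GevreyNLW.synth hσ (s - 1) (Φ (lift a b) t).2, fun a b hab => ?_,
    fun a b hab ε hε => ?_⟩
  · obtain ⟨z, hz, rfl, rfl⟩ := hdata a b hab
    simp only [hlift_synth]
    obtain ⟨h1, h2, h3⟩ := hΦ z hz
    refine ⟨?_, fun u v huv t ht => ?_, fun t _ => GevreyNLW.analyticInTube_synth hσ s _⟩
    · have := h1.isSolution hσ hNc hN
      rwa [h2] at this
    · obtain ⟨w, hw, hwuv⟩ := GevreyNLW.isStrongSol_of_isSolution hσ hNc hN huv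
      have h0 := hwuv 0 ⟨le_rfl, hδ⟩
      rw [huv.init, huv.init_deriv] at h0
      have hw0 : w 0 = z := Prod.ext (GevreyNLW.synth_injective hσ s h0.1.symm)
        (GevreyNLW.synth_injective hσ (s - 1) h0.2.symm)
      rw [← h3 w hw hw0 t ht]
      exact hwuv t ht
  · obtain ⟨z, hz, rfl, rfl⟩ := hdata a b hab
    set c : ℝ≥0∞ := 2 * ENNReal.ofReal L + 1 with hc
    have hct : c ≠ ⊤ := by finiteness
    have hc0 : c ≠ 0 := by simp [hc]
    refine ⟨ε / c, ENNReal.div_pos hε.ne' hct, fun a' b' hab' hη t ht => ?_⟩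
    obtain ⟨z', hz', rfl, rfl⟩ := hdata a' b' hab'
    simp only [hlift_synth]
    rw [GevreyNLW.pairDist_synth] at hη ⊢
    rw [ENNReal.lt_div_iff_mul_lt (Or.inl hc0) (Or.inl hct)] at hη
    refine lt_of_le_of_lt ?_ hη
    have h1 : ‖Φ z' t - Φ z t‖ₑ ≤ ENNReal.ofReal L * ‖z' - z‖ₑ := by
      rw [← ofReal_norm, ← ofReal_norm, ← ENNReal.ofReal_mul' (norm_nonneg _)]
      exact ENNReal.ofReal_le_ofReal (hL z' hz' z hz t ht)
    calc _ ≤ GevreyNLW.fourierScale d * (2 * (ENNReal.ofReal L *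
          (‖(z' - z).1‖ₑ + ‖(z' - z).2‖ₑ))) := by
          gcongr
          refine (GevreyNLW.enorm_fst_add_enorm_snd_le _).trans ?_
          gcongr
          refine h1.trans ?_
          gcongr
          exact GevreyNLW.enorm_le_enorm_fst_add_enorm_snd _
      _ = GevreyNLW.fourierScale d * (‖(z' - z).1‖ₑ + ‖(z' - z).2‖ₑ) * (2 * ENNReal.ofReal L) := by
          ring
      _ ≤ _ := by
          gcongr
          exact le_self_add
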